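/- Let $n,s\ge 0$ be integers and let $\alpha_1,\dots,\alpha_s\in\mathbb Z^n$ be non-zero vectors (not necessarily distinct) with non-negative coordinates that span $\mathbb Q^n$; write $\Delta$ for the family $(\alpha_1,\dots,\alpha_s)$. For $\gamma\in\mathbb Q^n$ let $P_\Delta(\gamma)$ be the number of $(a_1,\dots,a_s)\in\mathbb Z_{\ge 0}^s$ with $a_1\alpha_1+\dots+a_s\alpha_s=\gamma$, and let $\iota_X$ denote the indicator function of a set $X$. A pointed polyhedral cone is a set $C\subseteq\mathbb Q^n$ that is defined by finitely many inequalities $\langle a,x\rangle\ge 0$ with $a\in\mathbb Q^n$ and contains no line. A wall of $C$ is an intersection $C\cap H$, where $H$ is a hyperplane through the origin that bounds a closed half-space containing $C$, such that $C\cap H$ spans $H$. Call a hyperplane through the origin a $\Delta$-hyperplane if it is spanned by $n-1$ of the vectors $\alpha_1,\dots,\alpha_s$. Then there exist a full-rank lattice $\Lambda\subseteq\mathbb Z^n$, finitely many vectors $\delta_1,\dots,\delta_m\in\mathbb Z^n$ that are pairwise incongruent modulo $\Lambda$, finitely many full-dimensional pointed polyhedral cones $D_1,\dots,D_N\subseteq\mathbb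 Q^n$ with pairwise disjoint interiors, and polynomials $Q_{i,j}\in\mathbb Q[x_1,\dots,x_n]$ ($1\le i\le N$, $1\le j\le m$) such that the following hold. (a) For every $\gamma\in\mathbb Q^n$ one has $P_\Delta(\gamma)=Q_{i,j}(\gamma)$ whenever $\gamma\in D_i\cap(\delta_j+\Lambda)$, and $P_\Delta(\gamma)=0$ if $\gamma$ lies in none of the sets $D_i\cap(\delta_j+\Lambda)$. In particular, for all $\gamma$ that lie in at most one of the cones $D_i$, $$P_\Delta(\gamma)=\sum_{i,j}\iota_{D_i}(\gamma)\,\iota_{\delta_j+\Lambda}(\gamma)\,Q_{i,j}(\gamma).$$ In other words, the vector partition function is a quasipolynomial on each of the closed cones $D_i$ and zero elsewhere. Moreover, there are finitely many pointed polyhedral cones $E_1,\dots,E_M\subseteq\mathbb Q^n$ (possibly of smaller dimension) and polynomials $R_{i,j}\in\mathbb Q[x_1,\dots,x_n]$ such that for all $\gamma\in\mathbb Q^n$ $$P_\Delta(\gamma)=\sum_{i,j}\iota_{E_i}(\gamma)\,\iota_{\delta_j+\Lambda}(\gamma)\,R_{i,j}(\gamma).$$ (b) Every wall of every $D_i$ lies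 in a $\Delta$-hyperplane, and each of the cones $D_i$ and $E_i$ is an intersection of finitely many closed half-spaces bounded by $\Delta$-hyperplanes. -/

import Mathlib

namespace VectorPartition

/-- The integer vector `v`, viewed in `ℚⁿ`. -/
def toRat {n : ℕ} (v : Fin n → ℤ) : Fin n → ℚ := fun k => (v k : ℚ)

/-- The decompositions `γ = a₁ α₁ + ⋯ + aₛ αₛ` with non-negative integers `aᵢ`. -/
def decompositions {s n : ℕ} (α : Fin s → Fin n → ℤ) (γ : Fin n → ℚ) : Set (Fin s → ℕ) :=
  {a | ∑ i, (a i : ℚ) • toRat (α i) = γ}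

/-- The vector partition function `P_Δ(γ)`: the number of decompositions of `γ`. -/
noncomputable def partitionFunction {s n : ℕ} (α : Fin s → Fin n → ℤ) (γ : Fin n → ℚ) : ℕ :=
  (decompositions α γ).ncard

/-- For non-zero vectors with non-negative coordinates the number of decompositions is finite,
so that `partitionFunction` is the actual count. -/
theorem decompositions_finite {s n : ℕ} (α : Fin s → Fin n → ℤ)
    (hnonneg : ∀ i k, 0 ≤ α i k) (hne : ∀ i, α i ≠ 0) (γ : Fin n → ℚ) :
    (decompositions α γ).Finite := by
  refine (Set.finite_Iic (fun _ : Fin s => ⌈∑ k, |γ k|⌉₊)).subset ?_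
  intro a ha i
  obtain ⟨k, hk⟩ := Function.ne_iff.mp (hne i)
  have hk1 : (1 : ℚ) ≤ (α i k : ℚ) := by
    have h0 := hnonneg i k
    have h1 : α i k ≠ 0 := hk
    exact_mod_cast (by omega : (1 : ℤ) ≤ α i k)
  have hnn : ∀ j, (0 : ℚ) ≤ (a j : ℚ) * (α j k : ℚ) := fun j =>
    mul_nonneg (Nat.cast_nonneg _) (by exact_mod_cast hnonneg j k)
  have hsum : ∑ j, (a j : ℚ) * (α j k : ℚ) = γ k := by
    have := congrFun (show ∑ j, (a j : ℚ) • toRat (α j) = γ from ha) k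
    simpa [Finset.sum_apply, toRat] using this
  have h1 : (a i : ℚ) ≤ γ k := by
    calc (a i : ℚ) ≤ (a i : ℚ) * (α i k : ℚ) := le_mul_of_one_le_right (Nat.cast_nonneg _) hk1
      _ ≤ ∑ j, (a j : ℚ) * (α j k : ℚ) :=
        Finset.single_le_sum (f := fun j => (a j : ℚ) * (α j k : ℚ))
          (fun j _ => hnn j) (Finset.mem_univ i)
      _ = γ k := hsum
  have h2 : |γ k| ≤ ∑ k, |γ k| :=
    Finset.single_le_sum (f := fun k => |γ k|) (fun _ _ => abs_nonneg _) (Finset.mem_univ k)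
  exact_mod_cast (h1.trans (le_abs_self _)).trans (h2.trans (Nat.le_ceil _))

/-- `Λ ⊆ ℤⁿ` is a lattice of full rank: it is generated by `n` linearly independent integer
vectors. -/
def IsFullRankLattice {n : ℕ} (Λ : AddSubgroup (Fin n → ℤ)) : Prop :=
  ∃ b : Fin n → Fin n → ℤ, LinearIndependent ℤ b ∧ Λ = AddSubgroup.closure (Set.range b)

/-- The translate `δ + Λ`, as a subset of `ℚⁿ`. -/
def shift {n : ℕ} (δ : Fin n → ℤ) (Λ : AddSubgroup (Fin n → ℤ)) : Set (Fin n → ℚ) :=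
  {γ | ∃ l ∈ Λ, γ = toRat (δ + l)}

/-- The indicator function `ι_X`. -/
noncomputable def ind {n : ℕ} (X : Set (Fin n → ℚ)) (γ : Fin n → ℚ) : ℚ :=
  X.indicator (fun _ => 1) γ

/-- The set of solutions of the homogeneous inequalities `⟨a, x⟩ ≥ 0`, `a ∈ A`. -/
def coneOfNormals {n : ℕ} (A : Finset (Fin n → ℚ)) : Set (Fin n → ℚ) :=
  {x | ∀ a ∈ A, 0 ≤ a ⬝ᵥ x}

/-- A pointed polyhedral cone in `ℚⁿ`: it is given by finitely many homogeneous non-strict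
rational inequalities, and it contains no line. -/
def IsPointedPolyhedralCone {n : ℕ} (C : Set (Fin n → ℚ)) : Prop :=
  (∃ A : Finset (Fin n → ℚ), C = coneOfNormals A) ∧ ∀ x ∈ C, -x ∈ C → x = 0

/-- The linear subspace of all vectors orthogonal to `a` (a hyperplane when `a ≠ 0`). -/
def orth {n : ℕ} (a : Fin n → ℚ) : Submodule ℚ (Fin n → ℚ) where
  carrier := {x | a ⬝ᵥ x = 0}
  add_mem' {x y} hx hy := by
    simp only [Set.mem_ofPred_eq] at hx hy ⊢
    rw [dotProduct_add, hx, hy, add_zero]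
  zero_mem' := by simp
  smul_mem' c x hx := by
    simp only [Set.mem_ofPred_eq] at hx ⊢
    rw [dotProduct_smul, hx, smul_zero]

/-- `H` is the hyperplane of a wall of `C`: it is the boundary of a half-space containing `C`,
and it meets `C` in a set of dimension `n - 1`, that is, in a set spanning `H`. -/
def IsWallHyperplane {n : ℕ} (C : Set (Fin n → ℚ)) (H : Submodule ℚ (Fin n → ℚ)) : Prop :=
  ∃ a : Fin n → ℚ, a ≠ 0 ∧ H = orth a ∧ (∀ x ∈ C, 0 ≤ a ⬝ᵥ x) ∧
    Submodule.span ℚ (C ∩ (H : Set (Fin n → ℚ))) = H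

/-- `H` is spanned by `n - 1` of the vectors `α₁, …, αₛ`. -/
def IsSpannedBy {s n : ℕ} (α : Fin s → Fin n → ℤ) (H : Submodule ℚ (Fin n → ℚ)) : Prop :=
  ∃ I : Finset (Fin s), I.card + 1 = n ∧
    Submodule.span ℚ ((fun i => toRat (α i)) '' (I : Set (Fin s))) = H

/-- `C` is given by finitely many inequalities `⟨a, x⟩ ≥ 0` all of whose bounding hyperplanes
are spanned by `n - 1` of the vectors `α₁, …, αₛ`. -/
def IsCutOutBy {s n : ℕ} (α : Fin s → Fin n → ℤ) (C : Set (Fin n → ℚ)) : Prop :=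
  ∃ A : Finset (Fin n → ℚ), (∀ a ∈ A, IsSpannedBy α (orth a)) ∧ C = coneOfNormals A

end VectorPartition

/-!
The partition function is quasipolynomial on each closed chamber of the arrangement of the
hyperplanes spanned by `n - 1` of the vectors `α i`, for the chambers that meet the cone spanned by
the `α i`.

*Deep inside a chamber `C`.* Removing a vector from a subfamily `X` amounts to taking a difference:
`P_X (γ + α i) - P_X γ = P_{X \ {i}} (γ + α i)` for `i ∈ X` (`subCount_add`). The partition function
of a subfamily that does not span lives on a wall and so vanishes deep inside `C`
(`subCount_eventually_zero`). By induction on `X`, every difference operator with step in `N ℤⁿ` is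
nilpotent on the germ of `P_X` deep inside `C`, where `N` is such that `N ℤⁿ` lies in each lattice
generated by a spanning subfamily (`iterate_fwdDiff_subCount_eventually_zero`). Such a germ extends
uniquely to a function `q_X` on `ℤⁿ` annihilated by a power of each of these operators
(`exists_iterate_fwdDiff_eq_zero`, `eq_zero_of_iterate_fwdDiff_eq_zero`), and Newton interpolation
makes `q_X` a polynomial on each residue class modulo `N` (`exists_eval_eq_on_residue_class`).

*Up to the boundary.* By induction on `X`, in fact `P_X = q_X` at all integer points of `C - Z_X`,
where `Z_X` is the zonotope of `X` (`subCount_eq_of_mem_zonotopeRegion`). Write such a point as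
`γ = c - ∑ tᵢ αᵢ` and let `c` move to infinity in the direction of some `∑ bᵢ αᵢ ∈ C`, so that `tᵢ`
grows with speed `bᵢ`. Whenever some `tᵢ` reaches `1`, reset it to `0`, which replaces `γ` by
`γ + α i`, a point of `C - Z_{X \ {i}}`; by the induction hypothesis `P_X - q_X` does not change.
In the end `γ` is deep inside `C`, where the difference is `0`. The region `C - Z` of the whole
family contains all integer points of the closed chamber.

*Geometry.* The chambers that meet the cone of the `α i` cover it after taking closures
(`exists_chamber`); their walls lie in hyperplanes of the arrangement
(`isSpannedBy_of_isWallHyperplane`). The sum formula that is valid everywhere follows from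
`1_{y > 0} = 1_{y ≥ 0} - 1_{y = 0}`, which expresses the indicators of the relatively open cells of
the arrangement by those of the closed cells (`sum_ind_closedCell_mul_faceCoeff`).
-/

namespace VectorPartition

open fwdDiff Filter Topology

variable {n s : ℕ}


/-! ### The partition functions of subfamilies -/

theorem toRat_add (v w : Fin n → ℤ) : toRat (v + w) = toRat v + toRat w := by
  ext k; simp [toRat]

theorem toRat_zero : toRat (0 : Fin n → ℤ) = 0 := by
  ext k; simp [toRat]

theorem toRat_zsmul (m : ℤ) (v : Fin n → ℤ) : toRat (m • v) = (m : ℚ) • toRat v := by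
  ext k; simp [toRat]

theorem toRat_nsmul (m : ℕ) (v : Fin n → ℤ) : toRat (m • v) = (m : ℚ) • toRat v := by
  ext k; simp [toRat]

theorem toRat_injective : Function.Injective (toRat (n := n)) := by
  intro v w h
  ext k
  have := congrFun h k
  simpa [toRat] using this

theorem toRat_sum {ι : Type*} (t : Finset ι) (f : ι → Fin n → ℤ) :
    toRat (∑ i ∈ t, f i) = ∑ i ∈ t, toRat (f i) := by
  ext k; simp [toRat]

theorem toRat_sum_nsmul (α : Fin s → Fin n → ℤ) (a : Fin s → ℕ) :
    toRat (∑ i, a i • α i) = ∑ i, (a i : ℚ) • toRat (α i) := by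
  rw [toRat_sum]
  exact Finset.sum_congr rfl fun i _ => toRat_nsmul _ _

/-- The decompositions of the integer vector `γ` that use only the vectors `α i` with `i ∈ X`. -/
def subDecompositions (α : Fin s → Fin n → ℤ) (X : Finset (Fin s)) (γ : Fin n → ℤ) :
    Set (Fin s → ℕ) :=
  {a | (∀ i ∉ X, a i = 0) ∧ ∑ i, a i • α i = γ}

/-- The partition function of the subfamily indexed by `X`, as a rational-valued function on
`ℤⁿ`. -/
noncomputable def subCount (α : Fin s → Fin n → ℤ) (X : Finset (Fin s)) (γ : Fin n → ℤ) : ℚ :=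
  ((subDecompositions α X γ).ncard : ℚ)

theorem subDecompositions_univ (α : Fin s → Fin n → ℤ) (γ : Fin n → ℤ) :
    subDecompositions α Finset.univ γ = decompositions α (toRat γ) := by
  ext a
  simp only [subDecompositions, decompositions, Set.mem_ofPred_eq, Finset.mem_univ,
    not_true_eq_false, false_imp_iff, implies_true, true_and, ← toRat_sum_nsmul]
  exact toRat_injective.eq_iff.symm

theorem partitionFunction_toRat (α : Fin s → Fin n → ℤ) (γ : Fin n → ℤ) :
    (partitionFunction α (toRat γ) : ℚ) = subCount α Finset.univ γ := by
  rw [partitionFunction, subCount, subDecompositions_univ]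

theorem subDecompositions_finite (α : Fin s → Fin n → ℤ)
    (hnonneg : ∀ i k, 0 ≤ α i k) (hne : ∀ i, α i ≠ 0) (X : Finset (Fin s)) (γ : Fin n → ℤ) :
    (subDecompositions α X γ).Finite := by
  refine (decompositions_finite α hnonneg hne (toRat γ)).subset ?_
  rw [← subDecompositions_univ]
  exact fun a ha => ⟨fun i hi => absurd (Finset.mem_univ i) hi, ha.2⟩

theorem exists_of_subCount_ne_zero {α : Fin s → Fin n → ℤ} {X : Finset (Fin s)} {γ : Fin n → ℤ}
    (h : subCount α X γ ≠ 0) : ∃ a : Fin s → ℕ, (∀ i ∉ X, a i = 0) ∧ ∑ i, a i • α i = γ := by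
  by_contra hcon
  apply h
  have : subDecompositions α X γ = ∅ := by
    ext a
    simp only [Set.mem_empty_iff_false, iff_false]
    exact fun ha => hcon ⟨a, ha⟩
  simp [subCount, this]

theorem sum_add_single_nsmul (α : Fin s → Fin n → ℤ) (a : Fin s → ℕ) (i : Fin s) :
    ∑ j, (a + Pi.single i 1 : Fin s → ℕ) j • α j = ∑ j, a j • α j + α i := by
  simp only [Pi.add_apply, add_smul, Finset.sum_add_distrib]
  congr 1
  rw [Finset.sum_eq_single i]
  · simp
  · intro j _ hj; simp [hj]
  · simp

/-- Sorting the decompositions of `γ + α i` by whether they use `α i`. -/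
theorem subCount_add (α : Fin s → Fin n → ℤ)
    (hnonneg : ∀ i k, 0 ≤ α i k) (hne : ∀ i, α i ≠ 0) {X : Finset (Fin s)} {i : Fin s}
    (hi : i ∈ X) (γ : Fin n → ℤ) :
    subCount α X (γ + α i) = subCount α X γ + subCount α (X.erase i) (γ + α i) := by
  have hsplit : subDecompositions α X (γ + α i) =
      (fun a : Fin s → ℕ => a + Pi.single i 1) '' subDecompositions α X γ ∪
        subDecompositions α (X.erase i) (γ + α i) := by
    ext a
    constructor
    · rintro ⟨h1, h2⟩
      by_cases ha : a i = 0
      · refine Or.inr ⟨fun j hj => ?_, h2⟩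
        by_cases hji : j = i
        · rw [hji, ha]
        · exact h1 j fun hjX => hj (Finset.mem_erase.2 ⟨hji, hjX⟩)
      · have hle : Pi.single i 1 ≤ a := by
          intro j
          by_cases hji : j = i
          · subst hji; simp; omega
          · simp [hji]
        have hsub : a - Pi.single i 1 + Pi.single i 1 = a := tsub_add_cancel_of_le hle
        refine Or.inl ⟨a - Pi.single i 1, ⟨fun j hj => ?_, ?_⟩, hsub⟩
        · simp [h1 j hj]
        · have := sum_add_single_nsmul α (a - Pi.single i 1) i
          rw [hsub, h2] at this
          exact (add_right_cancel this).symm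
    · rintro (⟨b, ⟨h1, h2⟩, rfl⟩ | ⟨h1, h2⟩)
      · refine ⟨fun j hj => ?_, ?_⟩
        · have : j ≠ i := fun h => hj (h ▸ hi)
          simp [h1 j hj, this]
        · rw [← h2]; exact sum_add_single_nsmul α b i
      · exact ⟨fun j hj => h1 j fun h => hj (Finset.mem_of_mem_erase h), h2⟩
  have hdisj : Disjoint ((fun a : Fin s → ℕ => a + Pi.single i 1) '' subDecompositions α X γ)
      (subDecompositions α (X.erase i) (γ + α i)) := by
    rw [Set.disjoint_left]
    rintro _ ⟨b, _, rfl⟩ ⟨h1, _⟩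
    have := h1 i (by simp)
    simp at this
  rw [subCount, hsplit, Set.ncard_union_eq hdisj
    ((subDecompositions_finite α hnonneg hne X γ).image _)
    (subDecompositions_finite α hnonneg hne _ _),
    Set.ncard_image_of_injective _ (add_left_injective _), Nat.cast_add]
  rfl

theorem fwdDiff_subCount (α : Fin s → Fin n → ℤ)
    (hnonneg : ∀ i k, 0 ≤ α i k) (hne : ∀ i, α i ≠ 0) {X : Finset (Fin s)} {i : Fin s}
    (hi : i ∈ X) :
    Δ_[α i] (subCount α X) = fun γ => subCount α (X.erase i) (γ + α i) := by
  ext γ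
  simp [fwdDiff, subCount_add α hnonneg hne hi γ]

/-! ### A multiplier carrying the integer vectors into all spanned lattices -/

theorem exists_nsmul_mem_closure (S : Set (Fin n → ℤ)) {y : Fin n → ℚ}
    (hy : y ∈ Submodule.span ℚ (toRat '' S)) :
    ∃ N : ℕ, 0 < N ∧ ∃ w ∈ AddSubgroup.closure S, toRat w = (N : ℚ) • y := by
  induction hy using Submodule.span_induction with
  | mem x hx =>
    obtain ⟨w, hw, rfl⟩ := hx
    exact ⟨1, one_pos, w, AddSubgroup.subset_closure hw, by simp⟩
  | zero => exact ⟨1, one_pos, 0, zero_mem _, by simp [toRat_zero]⟩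
  | add x y _ _ hx hy =>
    obtain ⟨N, hN, w, hw, h1⟩ := hx
    obtain ⟨M, hM, z, hz, h2⟩ := hy
    refine ⟨N * M, Nat.mul_pos hN hM, M • w + N • z,
      add_mem (nsmul_mem hw M) (nsmul_mem hz N), ?_⟩
    rw [toRat_add, toRat_nsmul, toRat_nsmul, h1, h2, smul_add, smul_smul, smul_smul]
    push_cast
    rw [mul_comm (M : ℚ)]
  | smul c x _ hx =>
    obtain ⟨N, hN, w, hw, h1⟩ := hx
    refine ⟨c.den * N, Nat.mul_pos c.pos hN, c.num • w, zsmul_mem hw _, ?_⟩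
    rw [toRat_zsmul, h1, smul_smul, smul_smul]
    congr 1
    have := Rat.mul_den_eq_num c
    rw [← this]; push_cast; ring

/-- The linear span over `ℚ` of the vectors indexed by `X`. -/
def spanOf (α : Fin s → Fin n → ℤ) (X : Finset (Fin s)) : Submodule ℚ (Fin n → ℚ) :=
  Submodule.span ℚ ((fun i => toRat (α i)) '' (X : Set (Fin s)))

theorem eq_sum_single (v : Fin n → ℤ) : v = ∑ k, v k • (Pi.single k 1 : Fin n → ℤ) := by
  ext j
  simp [Finset.sum_apply, Pi.single_apply]

/-- There is an `N > 0` such that `N ℤⁿ` lies in the lattice generated by any spanning subfamily. -/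
theorem exists_multiplier (α : Fin s → Fin n → ℤ) :
    ∃ N : ℕ, 0 < N ∧ ∀ X : Finset (Fin s), spanOf α X = ⊤ → ∀ v : Fin n → ℤ,
      N • v ∈ AddSubgroup.closure (α '' (X : Set (Fin s))) := by
  have key : ∀ p : Finset (Fin s) × Fin n, ∃ N : ℕ, 0 < N ∧ (spanOf α p.1 = ⊤ →
      N • (Pi.single p.2 1 : Fin n → ℤ) ∈ AddSubgroup.closure (α '' (p.1 : Set (Fin s)))) := by
    rintro ⟨X, k⟩
    by_cases hX : spanOf α X = ⊤
    · have hmem : toRat (Pi.single k 1) ∈ Submodule.span ℚ (toRat '' (α '' (X : Set (Fin s)))) := by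
        rw [Set.image_image]
        have h : toRat (Pi.single k 1) ∈ spanOf α X := hX ▸ Submodule.mem_top
        exact h
      obtain ⟨N, hN, w, hw, h⟩ := exists_nsmul_mem_closure _ hmem
      refine ⟨N, hN, fun _ => ?_⟩
      rw [← toRat_nsmul] at h
      exact toRat_injective h ▸ hw
    · exact ⟨1, one_pos, fun h => absurd h hX⟩
  choose N hN h using key
  refine ⟨∏ p, N p, Finset.prod_pos fun p _ => hN p, fun X hX v => ?_⟩
  rw [eq_sum_single v, Finset.smul_sum]
  refine sum_mem fun k _ => ?_
  obtain ⟨m, hm⟩ := Finset.dvd_prod_of_mem N (Finset.mem_univ (X, k))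
  rw [hm, smul_comm, mul_comm, mul_smul]
  exact zsmul_mem (nsmul_mem (h (X, k) hX) m) _


/-! ### Behaviour deep inside an open polyhedral cone -/

section Deep

variable {J : Type*} [Finite J] (u : J → Fin n → ℚ)

/-- The filter of integer vectors going deep into the cone `{x | ∀ j, 0 < ⟨u j, x⟩}`: all the
functionals `u j` tend to `+∞`. -/
def deepFilter {J : Type*} (u : J → Fin n → ℚ) : Filter (Fin n → ℤ) :=
  comap (fun γ j => u j ⬝ᵥ toRat γ) atTop

variable {u} {P : (Fin n → ℤ) → Prop}

theorem eventually_deepFilter_iff :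
    (∀ᶠ γ in deepFilter u, P γ) ↔ ∃ K : ℚ, ∀ γ, (∀ j, K ≤ u j ⬝ᵥ toRat γ) → P γ := by
  have := Fintype.ofFinite J
  rw [deepFilter, ((atTop_basis (α := J → ℚ)).comap _).eventually_iff]
  constructor
  · rintro ⟨K, -, hK⟩
    refine ⟨∑ j, |K j|, fun γ hγ => hK fun j => ?_⟩
    exact ((le_abs_self _).trans (Finset.single_le_sum (f := fun j => |K j|)
      (fun _ _ => abs_nonneg _) (Finset.mem_univ j))).trans (hγ j)
  · rintro ⟨K, hK⟩
    exact ⟨fun _ => K, trivial, fun γ hγ => hK γ hγ⟩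

theorem tendsto_add_deepFilter (v : Fin n → ℤ) :
    Tendsto (fun γ => γ + v) (deepFilter u) (deepFilter u) := by
  have := Fintype.ofFinite J
  intro S hS
  obtain ⟨K, hK⟩ := eventually_deepFilter_iff.1 (show ∀ᶠ γ in deepFilter u, γ ∈ S from hS)
  refine eventually_deepFilter_iff.2 ⟨K + ∑ j, |u j ⬝ᵥ toRat v|, fun γ hγ => hK _ fun j => ?_⟩
  have h1 := Finset.single_le_sum (f := fun j => |u j ⬝ᵥ toRat v|)
    (fun _ _ => abs_nonneg _) (Finset.mem_univ j)
  have h2 := neg_abs_le (u j ⬝ᵥ toRat v)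
  have h3 := hγ j
  rw [toRat_add, dotProduct_add]
  linarith

theorem eventually_forall_add_nsmul {w : Fin n → ℤ} (hw : ∀ j, 0 ≤ u j ⬝ᵥ toRat w)
    (h : ∀ᶠ γ in deepFilter u, P γ) : ∀ᶠ γ in deepFilter u, ∀ k : ℕ, P (γ + k • w) := by
  obtain ⟨K, hK⟩ := eventually_deepFilter_iff.1 h
  refine eventually_deepFilter_iff.2 ⟨K, fun γ hγ k => hK _ fun j => ?_⟩
  rw [toRat_add, dotProduct_add, toRat_nsmul, dotProduct_smul, smul_eq_mul]
  have := mul_nonneg (Nat.cast_nonneg (α := ℚ) k) (hw j)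
  linarith [hγ j]

theorem tendsto_add_nsmul_deepFilter {w : Fin n → ℤ} (hw : ∀ j, 0 < u j ⬝ᵥ toRat w)
    (γ : Fin n → ℤ) : Tendsto (fun k : ℕ => γ + k • w) atTop (deepFilter u) := by
  rw [deepFilter, tendsto_comap_iff, tendsto_atTop]
  intro K
  simp only [Function.comp_apply, Pi.le_def, eventually_all]
  intro j
  have h1 : Tendsto (fun k : ℕ => (k : ℚ) * (u j ⬝ᵥ toRat w)) atTop atTop :=
    tendsto_natCast_atTop_atTop.atTop_mul_const (hw j)
  filter_upwards [h1.eventually_ge_atTop (K j - u j ⬝ᵥ toRat γ)] with k hk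
  rw [toRat_add, dotProduct_add, toRat_nsmul, dotProduct_smul, smul_eq_mul]
  linarith

end Deep

section Diff

theorem fwdDiff_comm {M : Type*} [AddCommMonoid M] (v w : M) :
    Function.Commute (fwdDiff v : (M → ℚ) → M → ℚ) (fwdDiff w) := by
  intro f
  ext γ
  simp only [fwdDiff, add_right_comm γ v w]
  ring

theorem iterate_fwdDiff_zero {M : Type*} [AddCommMonoid M] (v : M) (k : ℕ) :
    (fwdDiff v)^[k] (0 : M → ℚ) = 0 := by
  induction k with
  | zero => rfl
  | succ k ih =>
    rw [Function.iterate_succ_apply', ih]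
    ext; simp [fwdDiff]

theorem iterate_fwdDiff_sub {M : Type*} [AddCommMonoid M] (v : M) (k : ℕ) (f g : M → ℚ) :
    (fwdDiff v)^[k] (f - g) = (fwdDiff v)^[k] f - (fwdDiff v)^[k] g := by
  induction k with
  | zero => rfl
  | succ k ih =>
    simp only [Function.iterate_succ_apply', ih]
    ext; simp [fwdDiff]; ring

variable {J : Type*} [Finite J] {u : J → Fin n → ℚ} {f g : (Fin n → ℤ) → ℚ}

theorem eventuallyEq_add (h : f =ᶠ[deepFilter u] g) (v : Fin n → ℤ) :
    (fun γ => f (γ + v)) =ᶠ[deepFilter u] fun γ => g (γ + v) :=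
  (tendsto_add_deepFilter v).eventually h

theorem eventuallyEq_fwdDiff (h : f =ᶠ[deepFilter u] g) (v : Fin n → ℤ) :
    Δ_[v] f =ᶠ[deepFilter u] Δ_[v] g := by
  filter_upwards [h, eventuallyEq_add h v] with γ h1 h2
  simp only [fwdDiff, h1, h2]

theorem eventuallyEq_iterate_fwdDiff (h : f =ᶠ[deepFilter u] g) (v : Fin n → ℤ) (k : ℕ) :
    (fwdDiff v)^[k] f =ᶠ[deepFilter u] (fwdDiff v)^[k] g := by
  induction k with
  | zero => exact h
  | succ k ih =>
    rw [Function.iterate_succ_apply', Function.iterate_succ_apply']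
    exact eventuallyEq_fwdDiff ih v

theorem iterate_fwdDiff_eventually_zero_of_le {v : Fin n → ℤ} {k l : ℕ} (hkl : k ≤ l)
    (h : (fwdDiff v)^[k] f =ᶠ[deepFilter u] 0) : (fwdDiff v)^[l] f =ᶠ[deepFilter u] 0 := by
  obtain ⟨m, rfl⟩ := Nat.exists_eq_add_of_le hkl
  rw [add_comm, Function.iterate_add_apply]
  simpa only [iterate_fwdDiff_zero] using eventuallyEq_iterate_fwdDiff h v m

/-- A function that is polynomial along a direction `w` pointing into the cone is determined by
its values deep inside the cone. -/
theorem eq_zero_of_iterate_fwdDiff_eq_zero {w : Fin n → ℤ} (hw : ∀ j, 0 < u j ⬝ᵥ toRat w)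
    {M : ℕ} (hM : (fwdDiff w)^[M] f = 0) (hf : f =ᶠ[deepFilter u] 0) : f = 0 := by
  induction M generalizing f with
  | zero => exact hM
  | succ M ih =>
    rw [Function.iterate_succ_apply] at hM
    have h0 : Δ_[w] f = 0 := by
      refine ih hM ?_
      filter_upwards [eventuallyEq_fwdDiff hf w] with γ hγ
      rw [hγ]; simp [fwdDiff]
    have hconst : ∀ γ (k : ℕ), f (γ + k • w) = f γ := by
      intro γ k
      induction k with
      | zero => simp
      | succ k ihk =>
        rw [← ihk, succ_nsmul, ← add_assoc]
        exact sub_eq_zero.1 (congrFun h0 (γ + k • w))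
    ext γ
    obtain ⟨k, hk⟩ := ((tendsto_add_nsmul_deepFilter hw γ).eventually hf).exists
    rw [← hconst γ k, hk]
    rfl

/-- A solution of a difference equation deep inside the cone extends to a global solution: follow
the direction `w` into the cone and transport the value back. -/
theorem exists_fwdDiff_eq {w : Fin n → ℤ} (hw : ∀ j, 0 < u j ⬝ᵥ toRat w)
    (h : Δ_[w] f =ᶠ[deepFilter u] g) : ∃ q, Δ_[w] q = g ∧ q =ᶠ[deepFilter u] f := by
  set U : (Fin n → ℤ) → ℕ → ℚ :=
    fun γ k => f (γ + k • w) - ∑ j ∈ Finset.range k, g (γ + j • w) with hU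
  have hstep : ∀ γ k, Δ_[w] f (γ + k • w) = g (γ + k • w) → U γ (k + 1) = U γ k := by
    intro γ k hk
    simp only [hU, Finset.sum_range_succ, succ_nsmul, ← add_assoc, ← hk, fwdDiff]
    ring
  have hstab : ∀ γ, ∃ c, ∀ᶠ k in atTop, U γ k = c := by
    intro γ
    obtain ⟨k₀, hk₀⟩ := eventually_atTop.1 ((tendsto_add_nsmul_deepFilter hw γ).eventually h)
    refine ⟨U γ k₀, eventually_atTop.2 ⟨k₀, fun k hk => ?_⟩⟩
    induction k, hk using Nat.le_induction with
    | base => rfl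
    | succ k hk ih => rw [hstep γ k (hk₀ k hk), ih]
  choose q hq using hstab
  refine ⟨q, ?_, ?_⟩
  · ext γ
    have h2 := (tendsto_add_atTop_nat 1).eventually (hq γ)
    obtain ⟨k, h1, h3⟩ := ((hq (γ + w)).and h2).exists
    have h4 : U (γ + w) k = U γ (k + 1) + g γ := by
      simp only [hU, Finset.sum_range_succ', succ_nsmul, zero_nsmul, add_zero, add_assoc,
        add_comm w]
      ring
    simp only [fwdDiff]
    rw [← h1, ← h3, h4]
    ring
  · filter_upwards [eventually_forall_add_nsmul (fun j => (hw j).le) h] with γ hγ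
    have h1 : ∀ k, U γ k = f γ := by
      intro k
      induction k with
      | zero => simp [hU]
      | succ k ih => rw [hstep γ k (hγ k), ih]
    obtain ⟨k, hk⟩ := (hq γ).exists
    rw [← hk, h1]

theorem exists_iterate_fwdDiff_eq_zero {w : Fin n → ℤ} (hw : ∀ j, 0 < u j ⬝ᵥ toRat w) {M : ℕ}
    (h : (fwdDiff w)^[M] f =ᶠ[deepFilter u] 0) :
    ∃ q, (fwdDiff w)^[M] q = 0 ∧ q =ᶠ[deepFilter u] f := by
  induction M generalizing f with
  | zero => exact ⟨0, rfl, h.symm⟩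
  | succ M ih =>
    rw [Function.iterate_succ_apply] at h
    obtain ⟨g, hg, hgf⟩ := ih h
    obtain ⟨q, hq, hqf⟩ := exists_fwdDiff_eq hw hgf.symm
    exact ⟨q, by rw [Function.iterate_succ_apply, hq, hg], hqf⟩

end Diff

/-! ### The quasipolynomial that describes the partition function deep inside a chamber -/

section Chamber

variable {J : Type*} [Finite J] {u : J → Fin n → ℚ} {α : Fin s → Fin n → ℤ}

/-- Partition functions of subfamilies that do not span live on walls. -/
theorem subCount_eventually_zero
    (hu : ∀ X, spanOf α X ≠ ⊤ → ∃ j, ∀ i ∈ X, u j ⬝ᵥ toRat (α i) = 0)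
    {X : Finset (Fin s)} (hX : spanOf α X ≠ ⊤) : subCount α X =ᶠ[deepFilter u] 0 := by
  obtain ⟨j, hj⟩ := hu X hX
  refine eventually_deepFilter_iff.2 ⟨1, fun γ hγ => ?_⟩
  by_contra hne
  obtain ⟨a, ha, rfl⟩ := exists_of_subCount_ne_zero hne
  have h1 := hγ j
  rw [toRat_sum_nsmul, dotProduct_sum, Finset.sum_eq_zero] at h1
  · norm_num at h1
  · intro i _
    by_cases hi : i ∈ X
    · rw [dotProduct_smul, hj i hi, smul_zero]
    · simp [ha i hi]

/-- The vectors that leave a germ at infinity invariant form a group; so a germ killed by the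
differences along all `α i`, `i ∈ X`, is killed by those along the lattice that they generate. -/
theorem fwdDiff_eventually_zero_of_mem_closure {S : Set (Fin n → ℤ)} {f : (Fin n → ℤ) → ℚ}
    (h : ∀ v ∈ S, Δ_[v] f =ᶠ[deepFilter u] 0) {w : Fin n → ℤ} (hw : w ∈ AddSubgroup.closure S) :
    Δ_[w] f =ᶠ[deepFilter u] 0 := by
  induction hw using AddSubgroup.closure_induction with
  | mem v hv => exact h v hv
  | zero => exact Eventually.of_forall fun γ => by simp [fwdDiff]
  | add v w _ _ hv hw =>
    filter_upwards [hv, (tendsto_add_deepFilter v).eventually hw] with γ h1 h2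
    simp only [fwdDiff, Pi.zero_apply, ← add_assoc] at h1 h2 ⊢
    linarith
  | neg v _ hv =>
    filter_upwards [(tendsto_add_deepFilter (-v)).eventually hv] with γ h1
    simp only [fwdDiff, Pi.zero_apply, neg_add_cancel_right] at h1 ⊢
    linarith

/-- The hypothesis `hu` says that every subfamily that does not span lies in one of the hyperplanes
bounding the cone of `u`. Each vector removed from the subfamily costs one difference. -/
theorem iterate_fwdDiff_subCount_eventually_zero
    (hnonneg : ∀ i k, 0 ≤ α i k) (hne : ∀ i, α i ≠ 0)
    (hu : ∀ X, spanOf α X ≠ ⊤ → ∃ j, ∀ i ∈ X, u j ⬝ᵥ toRat (α i) = 0) {N : ℕ}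
    (hN : ∀ X : Finset (Fin s), spanOf α X = ⊤ → ∀ v : Fin n → ℤ,
      N • v ∈ AddSubgroup.closure (α '' (X : Set (Fin s))))
    (X : Finset (Fin s)) (v : Fin n → ℤ) :
    (fwdDiff (N • v))^[X.card + 1] (subCount α X) =ᶠ[deepFilter u] 0 := by
  induction X using Finset.strongInduction with
  | H X ih =>
    by_cases hX : spanOf α X = ⊤
    · rw [Function.iterate_succ_apply']
      refine fwdDiff_eventually_zero_of_mem_closure ?_ (hN X hX v)
      rintro _ ⟨i, hi, rfl⟩
      rw [← ((fwdDiff_comm (N • v) (α i)).iterate_left X.card).eq,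
        fwdDiff_subCount α hnonneg hne hi]
      have h1 := ih (X.erase i) (Finset.erase_ssubset hi)
      rw [Finset.card_erase_add_one hi] at h1
      have h2 := eventuallyEq_add h1 (α i)
      filter_upwards [h2] with γ hγ
      rw [fwdDiff_iter_comp_add]
      exact hγ
    · simpa only [iterate_fwdDiff_zero] using
        eventuallyEq_iterate_fwdDiff (subCount_eventually_zero hu hX) (N • v) (X.card + 1)

end Chamber


/-! ### From deep inside a chamber to the closed chamber -/

section Region

variable {J : Type*} {u : J → Fin n → ℚ} {α : Fin s → Fin n → ℤ}

/-- The open cone `{x | ∀ j, 0 < ⟨u j, x⟩}`. -/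
def openCone (u : J → Fin n → ℚ) : Set (Fin n → ℚ) :=
  {x | ∀ j, 0 < u j ⬝ᵥ x}

/-- The integer points of `C - Z`, where `C` is the open cone of `u` and
`Z = {∑ tᵢ αᵢ | 0 ≤ tᵢ ≤ 1}` is the zonotope of the subfamily indexed by `X`. -/
def zonotopeRegion (u : J → Fin n → ℚ) (α : Fin s → Fin n → ℤ) (X : Finset (Fin s)) :
    Set (Fin n → ℤ) :=
  {γ | ∃ t : Fin s → ℚ, (∀ i, 0 ≤ t i) ∧ (∀ i, t i ≤ 1) ∧ (∀ i ∉ X, t i = 0) ∧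
    toRat γ + ∑ i, t i • toRat (α i) ∈ openCone u}

theorem sum_update_zero (t : Fin s → ℚ) (i : Fin s) (ht : t i = 1) :
    ∑ j, Function.update t i 0 j • toRat (α j) + toRat (α i) = ∑ j, t j • toRat (α j) := by
  rw [← Finset.add_sum_erase _ _ (Finset.mem_univ i),
    ← Finset.add_sum_erase Finset.univ (fun j => t j • toRat (α j)) (Finset.mem_univ i), ht,
    Function.update_self, zero_smul, zero_add, one_smul, add_comm]
  congr 1
  refine Finset.sum_congr rfl fun j hj => ?_
  rw [Function.update_of_ne (Finset.ne_of_mem_erase hj)]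

theorem convexComb_mem_openCone {x y : Fin n → ℚ} (hx : x ∈ openCone u) (hy : y ∈ openCone u)
    {τ : ℚ} (h0 : 0 ≤ τ) (h1 : τ ≤ 1) : (1 - τ) • x + τ • y ∈ openCone u := by
  intro j
  rw [dotProduct_add, dotProduct_smul, dotProduct_smul, smul_eq_mul, smul_eq_mul]
  rcases h0.eq_or_lt with rfl | h0
  · simpa using hx j
  · exact add_pos_of_nonneg_of_pos (mul_nonneg (sub_nonneg.2 h1) (hx j).le) (mul_pos h0 (hy j))

/-- A function that is unchanged by each step `γ ↦ γ + α i` ending in the region of `X \ {i}` takes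
the same value at two points `γ` and `γ + ∑ kᵢ αᵢ` of the region of `X`. The segment between the
two points of the open cone attached to them is followed; whenever a zonotope coordinate reaches
`1`, it is reset to `0`, which is such a step. -/
theorem eq_of_steps {X : Finset (Fin s)} {d : (Fin n → ℤ) → ℚ}
    (hd : ∀ i ∈ X, ∀ γ, γ + α i ∈ zonotopeRegion u α (X.erase i) → d (γ + α i) = d γ)
    {k : Fin s → ℕ} (hk : ∀ i ∉ X, k i = 0) {γ : Fin n → ℤ} {t t' : Fin s → ℚ}
    (ht0 : ∀ i, 0 ≤ t i) (ht1 : ∀ i, t i ≤ 1) (htX : ∀ i ∉ X, t i = 0)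
    (ht0' : ∀ i, 0 ≤ t' i) (ht1' : ∀ i, t' i ≤ 1) (htX' : ∀ i ∉ X, t' i = 0)
    (hC : toRat γ + ∑ i, t i • toRat (α i) ∈ openCone u)
    (hC' : toRat (γ + ∑ i, k i • α i) + ∑ i, t' i • toRat (α i) ∈ openCone u) :
    d (γ + ∑ i, k i • α i) = d γ := by
  obtain ⟨m, hm⟩ : ∃ m, ∑ i, k i = m := ⟨_, rfl⟩
  induction m generalizing k γ t with
  | zero =>
    have h0 : ∀ i, k i = 0 := fun i => Finset.sum_eq_zero_iff.1 hm i (Finset.mem_univ i)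
    simp [h0]
  | succ m ih =>
    -- Along the segment, parametrized by `[0, 1]`, the `i`-th zonotope coordinate, if never reset,
    -- grows with speed `b i`; it reaches `1` at the time `T i`. If `b i = 0` and `1 ≤ k i`, then
    -- `t i = 1`, and the junk value `T i = 0` is the correct time.
    set b : Fin s → ℚ := fun i => k i + t' i - t i with hb
    set T : Fin s → ℚ := fun i => (1 - t i) / b i with hT
    have hne : (Finset.univ.filter fun i => 1 ≤ k i).Nonempty := by
      by_contra hcon
      rw [Finset.not_nonempty_iff_eq_empty, Finset.filter_eq_empty_iff] at hcon
      have : ∑ i, k i = 0 := Finset.sum_eq_zero fun i hi => by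
        have := hcon hi; omega
      omega
    obtain ⟨i, hi, hmin⟩ := Finset.exists_min_image _ T hne
    have hki : 1 ≤ k i := (Finset.mem_filter.1 hi).2
    have hiX : i ∈ X := by
      by_contra h
      have := hk i h
      omega
    have hbge : ∀ j, 1 ≤ k j → 1 - t j ≤ b j := by
      intro j hj
      have h1 : (1 : ℚ) ≤ k j := by exact_mod_cast hj
      have h2 := ht0' j
      simp only [hb]
      linarith
    have hTb : ∀ j, 1 ≤ k j → T j * b j = 1 - t j := by
      intro j hj
      refine div_mul_cancel_of_imp fun h0 => ?_
      have h1 := hbge j hj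
      have h2 := ht1 j
      linarith
    -- Up to the time `τ` of the first reset no coordinate leaves `[0, 1]`.
    set τ := T i with hτ
    have hτ0 : 0 ≤ τ :=
      div_nonneg (by linarith [ht1 i]) (by linarith [ht1 i, hbge i hki])
    have hτ1 : τ ≤ 1 := div_le_one_of_le₀ (hbge i hki) (by linarith [ht1 i, hbge i hki])
    set t₁ : Fin s → ℚ := fun j => t j + τ * b j with ht₁
    have ht₁i : t₁ i = 1 := by simp only [ht₁, hτ, hTb i hki]; ring
    have hzero : ∀ j, k j = 0 → t₁ j = (1 - τ) * t j + τ * t' j := by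
      intro j hj
      simp only [ht₁, hb, hj]
      push_cast
      ring
    have h0 : ∀ j, 0 ≤ t₁ j := by
      intro j
      rcases Nat.eq_zero_or_pos (k j) with hj | hj
      · rw [hzero j hj]
        have := mul_nonneg (sub_nonneg.2 hτ1) (ht0 j)
        have := mul_nonneg hτ0 (ht0' j)
        linarith
      · have h1 := hbge j hj
        have := mul_nonneg hτ0 (by linarith [ht1 j] : 0 ≤ b j)
        simp only [ht₁]
        linarith [ht0 j]
    have h1 : ∀ j, t₁ j ≤ 1 := by
      intro j
      rcases Nat.eq_zero_or_pos (k j) with hj | hj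
      · rw [hzero j hj]
        have := mul_le_mul_of_nonneg_left (ht1 j) (sub_nonneg.2 hτ1)
        have := mul_le_mul_of_nonneg_left (ht1' j) hτ0
        linarith
      · have h2 := hmin j (Finset.mem_filter.2 ⟨Finset.mem_univ j, hj⟩)
        have h3 := mul_le_mul_of_nonneg_right h2 (by linarith [ht1 j, hbge j hj] : 0 ≤ b j)
        rw [hTb j hj] at h3
        simp only [ht₁]
        linarith
    have hX1 : ∀ j ∉ X, t₁ j = 0 := by
      intro j hj
      rw [hzero j (hk j hj), htX j hj, htX' j hj]
      ring
    have hC1 : toRat γ + ∑ j, t₁ j • toRat (α j) ∈ openCone u := by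
      have heq : toRat γ + ∑ j, t₁ j • toRat (α j) =
          (1 - τ) • (toRat γ + ∑ i, t i • toRat (α i)) +
            τ • (toRat (γ + ∑ i, k i • α i) + ∑ i, t' i • toRat (α i)) := by
        rw [toRat_add, toRat_sum_nsmul]
        simp only [ht₁, hb, add_smul, sub_smul, mul_smul, mul_add, mul_sub, Finset.sum_add_distrib,
          Finset.sum_sub_distrib, smul_add, Finset.smul_sum, one_smul]
        abel
      rw [heq]
      exact convexComb_mem_openCone hC hC' hτ0 hτ1
    have hC2 : toRat (γ + α i) + ∑ j, Function.update t₁ i 0 j • toRat (α j) ∈ openCone u := by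
      rw [toRat_add, add_assoc, add_comm (toRat (α i)), sum_update_zero t₁ i ht₁i]
      exact hC1
    have h0' : ∀ j, 0 ≤ Function.update t₁ i 0 j := by
      intro j
      by_cases hj : j = i
      · subst hj; simp
      · rw [Function.update_of_ne hj]; exact h0 j
    have h1' : ∀ j, Function.update t₁ i 0 j ≤ 1 := by
      intro j
      by_cases hj : j = i
      · subst hj; simp
      · rw [Function.update_of_ne hj]; exact h1 j
    have hX1' : ∀ j ∉ X.erase i, Function.update t₁ i 0 j = 0 := by
      intro j hj
      by_cases hji : j = i
      · subst hji; simp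
      · rw [Function.update_of_ne hji]
        exact hX1 j fun h => hj (Finset.mem_erase.2 ⟨hji, h⟩)
    have hstep : d (γ + α i) = d γ := hd i hiX γ ⟨_, h0', h1', hX1', hC2⟩
    have hk' : k = (k - Pi.single i 1) + Pi.single i 1 := by
      refine (tsub_add_cancel_of_le fun j => ?_).symm
      by_cases hj : j = i
      · subst hj; simpa using hki
      · simp [hj]
    have hsum : γ + ∑ j, k j • α j = γ + α i + ∑ j, (k - Pi.single i 1 : Fin s → ℕ) j • α j := by
      conv_lhs => rw [hk', sum_add_single_nsmul]
      abel
    have hcard : ∑ j, (k - Pi.single i 1 : Fin s → ℕ) j = m := by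
      have h2 : ∑ j, k j = ∑ j, (k - Pi.single i 1 : Fin s → ℕ) j + 1 := by
        conv_lhs => rw [hk']
        simp only [Pi.add_apply, Finset.sum_add_distrib]
        simp
      omega
    rw [hsum, ← hstep]
    refine ih (k := k - Pi.single i 1) (fun j hj => ?_) h0' h1'
      (fun j hj => hX1' j fun h => hj (Finset.mem_of_mem_erase h)) hC2 ?_ hcard
    · simp [hk j hj]
    · rw [← hsum]; exact hC'

/-- Non-negative rational coefficients become natural numbers after scaling. -/
theorem exists_natural_multiple (a : Fin s → ℚ) (ha : ∀ i, 0 ≤ a i) :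
    ∃ L : ℕ, 0 < L ∧ ∃ b : Fin s → ℕ, ∀ i, (b i : ℚ) = L * a i := by
  refine ⟨∏ i, (a i).den, Finset.prod_pos fun i _ => (a i).pos, ?_⟩
  have : ∀ i, ∃ b : ℕ, (b : ℚ) = (∏ i, (a i).den : ℕ) * a i := by
    intro i
    obtain ⟨m, hm⟩ := Finset.dvd_prod_of_mem (fun i => (a i).den) (Finset.mem_univ i)
    refine ⟨(a i).num.toNat * m, ?_⟩
    have h1 : (((a i).num.toNat : ℤ) : ℚ) = (a i).num := by
      rw [Int.toNat_of_nonneg (Rat.num_nonneg.2 (ha i))]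
    rw [hm, Nat.cast_mul, Nat.cast_mul, ← Int.cast_natCast, h1, ← Rat.mul_den_eq_num (a i)]
    ring
  choose b hb using this
  exact ⟨b, hb⟩

theorem smul_mem_openCone {x : Fin n → ℚ} (hx : x ∈ openCone u) {c : ℚ} (hc : 0 < c) :
    c • x ∈ openCone u := by
  intro j
  rw [dotProduct_smul, smul_eq_mul]
  exact mul_pos hc (hx j)

theorem exists_natural_mem_openCone {X : Finset (Fin s)} {a : Fin s → ℚ} (ha : ∀ i, 0 ≤ a i)
    (haX : ∀ i ∉ X, a i = 0) (hC : ∑ i, a i • toRat (α i) ∈ openCone u) :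
    ∃ b : Fin s → ℕ, (∀ i ∉ X, b i = 0) ∧ toRat (∑ i, b i • α i) ∈ openCone u := by
  obtain ⟨L, hL, b, hb⟩ := exists_natural_multiple a ha
  refine ⟨b, fun i hi => ?_, ?_⟩
  · have := hb i
    rw [haX i hi, mul_zero] at this
    exact_mod_cast this
  · have heq : toRat (∑ i, b i • α i) = (L : ℚ) • ∑ i, a i • toRat (α i) := by
      rw [toRat_sum_nsmul, Finset.smul_sum]
      exact Finset.sum_congr rfl fun i _ => by rw [hb i, mul_smul]
    rw [heq]
    exact smul_mem_openCone hC (by exact_mod_cast hL)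

/-- On the closed cone and on the whole region `C - Z` the partition functions of the subfamilies
agree with any system of functions that has the same germs deep inside the cone and satisfies the
same difference equations. -/
theorem subCount_eq_of_mem_zonotopeRegion [Finite J]
    (hnonneg : ∀ i k, 0 ≤ α i k) (hne : ∀ i, α i ≠ 0)
    {q : Finset (Fin s) → (Fin n → ℤ) → ℚ}
    (hq : ∀ X, q X =ᶠ[deepFilter u] subCount α X)
    (hq0 : ∀ X, subCount α X =ᶠ[deepFilter u] 0 → q X = 0)
    (hdiff : ∀ X, ∀ i ∈ X, Δ_[α i] (q X) = fun γ => q (X.erase i) (γ + α i))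
    (X : Finset (Fin s)) {γ : Fin n → ℤ} (hγ : γ ∈ zonotopeRegion u α X) :
    subCount α X γ = q X γ := by
  induction X using Finset.strongInduction generalizing γ with
  | H X ih =>
    by_cases hX : ∃ b : Fin s → ℕ, (∀ i ∉ X, b i = 0) ∧ toRat (∑ i, b i • α i) ∈ openCone u
    · obtain ⟨b, hbX, hb⟩ := hX
      set d : (Fin n → ℤ) → ℚ := subCount α X - q X with hd
      have hstep : ∀ i ∈ X, ∀ γ, γ + α i ∈ zonotopeRegion u α (X.erase i) →
          d (γ + α i) = d γ := by
        intro i hi γ hγ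
        have h1 := ih (X.erase i) (Finset.erase_ssubset hi) hγ
        have h2 := subCount_add α hnonneg hne hi γ
        have h3 := congrFun (hdiff X i hi) γ
        simp only [fwdDiff] at h3
        simp only [hd, Pi.sub_apply]
        linarith
      obtain ⟨t, ht0, ht1, htX, hC⟩ := hγ
      -- Both ends of the path have the same zonotope coordinates `t`.
      have hconst : ∀ k : ℕ, d (γ + k • ∑ i, b i • α i) = d γ := by
        intro k
        have heq : k • ∑ i, b i • α i = ∑ i, (k * b i) • α i := by
          rw [Finset.smul_sum]
          exact Finset.sum_congr rfl fun i _ => (mul_smul _ _ _).symm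
        rw [heq]
        refine eq_of_steps (k := fun i => k * b i) hstep (fun i hi => ?_) ht0 ht1 htX ht0 ht1 htX
          hC ?_
        · simp [hbX i hi]
        · intro j
          have h1 := hC j
          have h2 := mul_nonneg (Nat.cast_nonneg (α := ℚ) k) (hb j).le
          rw [← heq, toRat_add, add_right_comm, dotProduct_add, toRat_nsmul, dotProduct_smul,
            smul_eq_mul]
          linarith
      have hev : d =ᶠ[deepFilter u] 0 := by
        filter_upwards [hq X] with γ hγ
        simp [hd, hγ]
      obtain ⟨k, hk⟩ := ((tendsto_add_nsmul_deepFilter hb γ).eventually hev).exists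
      rw [hconst k] at hk
      exact sub_eq_zero.1 hk
    · -- The cone spanned by the subfamily misses the chamber, so both sides vanish.
      have hev : subCount α X =ᶠ[deepFilter u] 0 := by
        refine eventually_deepFilter_iff.2 ⟨1, fun γ hγ => ?_⟩
        by_contra hcon
        obtain ⟨a, haX, rfl⟩ := exists_of_subCount_ne_zero hcon
        exact hX ⟨a, haX, fun j => one_pos.trans_le (hγ j)⟩
      rw [hq0 X hev, Pi.zero_apply]
      by_contra hcon
      obtain ⟨a, haX, rfl⟩ := exists_of_subCount_ne_zero hcon
      obtain ⟨t, ht0, ht1, htX, hC⟩ := hγ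
      refine hX (exists_natural_mem_openCone (a := fun i => a i + t i) (fun i => ?_)
        (fun i hi => ?_) ?_)
      · have := ht0 i; positivity
      · simp [haX i hi, htX i hi]
      · simpa only [add_smul, Finset.sum_add_distrib, toRat_sum_nsmul] using hC

/-- On a closed chamber that meets the cone spanned by the `αᵢ`, the partition function agrees with
a function on `ℤⁿ` that is annihilated by a power of each difference operator of step in `N ℤⁿ`. -/
theorem exists_subCount_eq_on_closed_chamber [Finite J]
    (hnonneg : ∀ i k, 0 ≤ α i k) (hne : ∀ i, α i ≠ 0)
    (hu : ∀ X, spanOf α X ≠ ⊤ → ∃ j, ∀ i ∈ X, u j ⬝ᵥ toRat (α i) = 0) {N : ℕ} (hNpos : 0 < N)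
    (hN : ∀ X : Finset (Fin s), spanOf α X = ⊤ → ∀ v : Fin n → ℤ,
      N • v ∈ AddSubgroup.closure (α '' (X : Set (Fin s))))
    {b : Fin s → ℕ} (hb : toRat (∑ i, b i • α i) ∈ openCone u) :
    ∃ q : (Fin n → ℤ) → ℚ, (∀ v : Fin n → ℤ, (fwdDiff (N • v))^[s + 1] q = 0) ∧
      ∀ γ, (∀ j, 0 ≤ u j ⬝ᵥ toRat γ) → subCount α Finset.univ γ = q γ := by
  have hw : ∀ j, 0 < u j ⬝ᵥ toRat (N • ∑ i, b i • α i) := by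
    rw [toRat_nsmul]
    exact smul_mem_openCone hb (by exact_mod_cast hNpos)
  set w := N • ∑ i, b i • α i with hwdef
  have hker : ∀ X v, (fwdDiff (N • v))^[s + 1] (subCount α X) =ᶠ[deepFilter u] 0 := fun X v =>
    iterate_fwdDiff_eventually_zero_of_le
      (Nat.succ_le_succ ((Finset.card_le_univ X).trans_eq (Fintype.card_fin s)))
      (iterate_fwdDiff_subCount_eventually_zero hnonneg hne hu hN X v)
  choose q hq hqev using fun X => exists_iterate_fwdDiff_eq_zero hw (hker X _)
  refine ⟨q Finset.univ, fun v => ?_, fun γ hγ => ?_⟩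
  · refine eq_zero_of_iterate_fwdDiff_eq_zero (M := s + 1) hw ?_
      ((eventuallyEq_iterate_fwdDiff (hqev _) (N • v) (s + 1)).trans (hker _ v))
    rw [((fwdDiff_comm w (N • v)).iterate_iterate (s + 1) (s + 1)).eq, hq, iterate_fwdDiff_zero]
  · refine subCount_eq_of_mem_zonotopeRegion hnonneg hne hqev (fun X hX => ?_)
      (fun X i hi => ?_) Finset.univ ?_
    · exact eq_zero_of_iterate_fwdDiff_eq_zero hw (hq X) ((hqev X).trans hX)
    · rw [← sub_eq_zero]
      refine eq_zero_of_iterate_fwdDiff_eq_zero (M := s + 1) hw ?_ ?_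
      · rw [iterate_fwdDiff_sub, ((fwdDiff_comm w (α i)).iterate_left (s + 1)).eq, hq]
        ext γ
        simp only [Pi.sub_apply, fwdDiff_iter_comp_add, hq, fwdDiff]
        simp
      · have h1 := eventuallyEq_fwdDiff (hqev X) (α i)
        rw [fwdDiff_subCount α hnonneg hne hi] at h1
        filter_upwards [h1, eventuallyEq_add (hqev (X.erase i)) (α i)] with γ h2 h3
        simp only [Pi.sub_apply, h2, h3, Pi.zero_apply, sub_self]
    · -- A small multiple of `∑ bᵢ αᵢ` lies in the zonotope and pushes `γ` into the open cone.
      have hpos : (0 : ℚ) < 1 + ∑ i, (b i : ℚ) := by positivity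
      refine ⟨fun i => (1 + ∑ i, (b i : ℚ))⁻¹ * b i, fun i => by positivity, fun i => ?_,
        fun i hi => absurd (Finset.mem_univ i) hi, fun j => ?_⟩
      · rw [inv_mul_le_iff₀ hpos, mul_one]
        have := Finset.single_le_sum (f := fun i => (b i : ℚ)) (fun i _ => Nat.cast_nonneg _)
          (Finset.mem_univ i)
        linarith
      · have h1 : ∑ i, ((1 + ∑ i, (b i : ℚ))⁻¹ * b i) • toRat (α i) =
            (1 + ∑ i, (b i : ℚ))⁻¹ • toRat (∑ i, b i • α i) := by
          rw [toRat_sum_nsmul, Finset.smul_sum]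
          exact Finset.sum_congr rfl fun i _ => mul_smul _ _ _
        have h2 := smul_mem_openCone hb (inv_pos.2 hpos) j
        rw [h1, dotProduct_add]
        linarith [hγ j]

end Region


/-! ### Functions killed by iterated differences are polynomials on residue classes -/

/-- Newton's interpolation formula along a direction, valid for negative multiples as well. -/
theorem eq_sum_choose_mul_iterate_fwdDiff {A : Type*} [AddCommGroup A] {v : A} {M : ℕ} {f : A → ℚ}
    (hf : (fwdDiff v)^[M] f = 0) (x : A) (z : ℤ) :
    f (x + z • v) = ∑ j ∈ Finset.range M, Ring.choose (z : ℚ) j * (fwdDiff v)^[j] f x := by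
  induction M generalizing f z with
  | zero =>
    have h : f = 0 := hf
    simp [h]
  | succ M ih =>
    rw [Function.iterate_succ_apply] at hf
    set R : ℤ → ℚ := fun z => f (x + z • v) -
      ∑ j ∈ Finset.range (M + 1), Ring.choose (z : ℚ) j * (fwdDiff v)^[j] f x with hR
    have hstep : ∀ z, R (z + 1) = R z := by
      intro z
      have h1 := ih hf z
      have h2 : ∑ j ∈ Finset.range (M + 1), Ring.choose ((z + 1 : ℤ) : ℚ) j * (fwdDiff v)^[j] f x =
          ∑ j ∈ Finset.range M, Ring.choose (z : ℚ) j * (fwdDiff v)^[j] (fwdDiff v f) x +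
            ∑ j ∈ Finset.range (M + 1), Ring.choose (z : ℚ) j * (fwdDiff v)^[j] f x := by
        simp only [Finset.sum_range_succ', ← Function.iterate_succ_apply, Ring.choose_zero_right,
          Int.cast_add, Int.cast_one, Ring.choose_succ_succ, add_mul, Finset.sum_add_distrib]
        ring
      simp only [hR]
      rw [h2, ← h1, fwdDiff, add_smul, one_smul, add_assoc]
      ring
    have hzero : R 0 = 0 := by
      simp only [hR, zero_smul, add_zero, Int.cast_zero]
      rw [Finset.sum_range_succ', Finset.sum_eq_zero]
      · simp
      · intro j _
        rw [Ring.choose_zero_succ, zero_mul]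
    have hall : ∀ z, R z = 0 := by
      intro z
      induction z using Int.induction_on with
      | zero => exact hzero
      | succ k ihk => rw [hstep, ihk]
      | pred k ihk => rw [← hstep, sub_add_cancel, ihk]
    exact sub_eq_zero.1 (hall z)

theorem exists_eval_eq_choose (i : Fin n) (j : ℕ) :
    ∃ p : MvPolynomial (Fin n) ℚ, ∀ y : Fin n → ℚ, MvPolynomial.eval y p = Ring.choose (y i) j := by
  refine ⟨MvPolynomial.C (j.factorial : ℚ)⁻¹ *
    Polynomial.aeval (MvPolynomial.X i) (descPochhammer ℤ j), fun y => ?_⟩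
  rw [Ring.choose_eq_smul, smul_eq_mul, map_mul, MvPolynomial.eval_C,
    ← Polynomial.aeval_eq_smeval]
  congr 1
  have h := Polynomial.map_aeval_eq_aeval_map (φ := RingHom.id ℤ) (ψ := MvPolynomial.eval y)
    (RingHom.ext_int _ _) (descPochhammer ℤ j) (MvPolynomial.X i)
  rw [h, Polynomial.map_id, MvPolynomial.eval_X]

/-- One-dimensional interpolation, applied to one coordinate after the other. The coefficients of
the interpolation are differences of `f` and so satisfy the same hypothesis. -/
theorem exists_eval_eq_of_iterate_fwdDiff {A : Type*} [AddCommGroup A] {v : Fin n → A} {M : ℕ}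
    (S : Finset (Fin n)) {f : A → ℚ} (hf : ∀ i, (fwdDiff (v i))^[M] f = 0) (x : A) :
    ∃ p : MvPolynomial (Fin n) ℚ, ∀ l : Fin n → ℤ,
      f (x + ∑ i ∈ S, l i • v i) = MvPolynomial.eval (toRat l) p := by
  induction S using Finset.induction_on generalizing f with
  | empty => exact ⟨MvPolynomial.C (f x), fun l => by simp⟩
  | insert i S hi ih =>
    have hj : ∀ j, ∃ p : MvPolynomial (Fin n) ℚ, ∀ l : Fin n → ℤ,
        (fwdDiff (v i))^[j] f (x + ∑ i ∈ S, l i • v i) = MvPolynomial.eval (toRat l) p := by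
      intro j
      refine ih fun i' => ?_
      rw [((fwdDiff_comm (v i') (v i)).iterate_iterate M j).eq, hf, iterate_fwdDiff_zero]
    choose p hp using hj
    choose c hc using exists_eval_eq_choose i
    refine ⟨∑ j ∈ Finset.range M, c j * p j, fun l => ?_⟩
    rw [Finset.sum_insert hi, add_comm (l i • v i), ← add_assoc,
      eq_sum_choose_mul_iterate_fwdDiff (hf i), map_sum]
    refine Finset.sum_congr rfl fun j _ => ?_
    rw [map_mul, hc, hp]
    rfl

/-- The lattice `N ℤⁿ`. -/
def multiples (n N : ℕ) : AddSubgroup (Fin n → ℤ) :=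
  (nsmulAddMonoidHom (α := Fin n → ℤ) N).range

theorem isFullRankLattice_multiples {N : ℕ} (hN : 0 < N) :
    IsFullRankLattice (multiples n N) := by
  refine ⟨fun k => N • Pi.single k 1, ?_, ?_⟩
  · rw [Fintype.linearIndependent_iff]
    intro g hg i
    have := congrFun hg i
    simp [Finset.sum_apply, Pi.single_apply] at this
    omega
  · apply le_antisymm
    · rintro _ ⟨v, rfl⟩
      rw [nsmulAddMonoidHom_apply, eq_sum_single v, Finset.smul_sum]
      refine sum_mem fun k _ => ?_
      rw [smul_comm]
      exact zsmul_mem (AddSubgroup.subset_closure (Set.mem_range_self k)) _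
    · rw [AddSubgroup.closure_le]
      rintro _ ⟨k, rfl⟩
      exact ⟨_, rfl⟩

/-- The polynomial in the coordinates of `l / N` becomes one in those of `δ + l` by substituting
`(xₖ - δₖ) / N`. -/
theorem exists_eval_eq_on_residue_class {N M : ℕ} (hN : 0 < N) {q : (Fin n → ℤ) → ℚ}
    (hq : ∀ v : Fin n → ℤ, (fwdDiff (N • v))^[M] q = 0) (δ : Fin n → ℤ) :
    ∃ Q : MvPolynomial (Fin n) ℚ, ∀ l ∈ multiples n N,
      q (δ + l) = MvPolynomial.eval (toRat (δ + l)) Q := by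
  obtain ⟨p, hp⟩ := exists_eval_eq_of_iterate_fwdDiff (v := fun k => N • Pi.single k 1)
    Finset.univ (fun i => hq _) δ
  refine ⟨MvPolynomial.bind₁ (fun k => MvPolynomial.C (N : ℚ)⁻¹ *
    (MvPolynomial.X k - MvPolynomial.C (δ k : ℚ))) p, ?_⟩
  rintro _ ⟨v, rfl⟩
  have h1 : (nsmulAddMonoidHom N) v = ∑ k, v k • (N • (Pi.single k 1 : Fin n → ℤ)) := by
    rw [nsmulAddMonoidHom_apply]
    conv_lhs => rw [eq_sum_single v, Finset.smul_sum]
    exact Finset.sum_congr rfl fun k _ => smul_comm _ _ _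
  rw [MvPolynomial.eval, MvPolynomial.eval₂Hom_bind₁]
  rw [h1, hp v, ← h1, MvPolynomial.eval]
  congr 2
  ext k
  have : (N : ℚ) ≠ 0 := by exact_mod_cast hN.ne'
  simp [toRat]
  field_simp

/-- The standard representatives of `ℤⁿ / N ℤⁿ`. -/
def residue {n N : ℕ} (r : Fin n → Fin N) : Fin n → ℤ := fun k => ((r k : ℕ) : ℤ)

theorem residue_injective_mod {N : ℕ} {r r' : Fin n → Fin N}
    (h : residue r - residue r' ∈ multiples n N) : r = r' := by
  obtain ⟨v, hv⟩ := h
  ext k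
  have hk := congrFun hv k
  simp only [residue, nsmulAddMonoidHom_apply, Pi.smul_apply, Pi.sub_apply, nsmul_eq_mul] at hk
  have h1 : ((r k : ℕ) : ℤ) ≡ ((r' k : ℕ) : ℤ) [ZMOD N] :=
    (Int.modEq_iff_dvd.2 ⟨v k, hk.symm⟩).symm
  have h2 := (Int.natCast_modEq_iff).1 h1
  exact Nat.ModEq.eq_of_lt_of_lt h2 (r k).2 (r' k).2

theorem exists_residue {N : ℕ} (hN : 0 < N) (γ : Fin n → ℤ) :
    ∃ r : Fin n → Fin N, ∃ l ∈ multiples n N, γ = residue r + l := by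
  have hN' : (0 : ℤ) < N := by exact_mod_cast hN
  refine ⟨fun k => ⟨(γ k % N).toNat, ?_⟩, _, ⟨fun k => γ k / N, rfl⟩, ?_⟩
  · have := Int.emod_lt_of_pos (γ k) hN'
    have := Int.emod_nonneg (γ k) hN'.ne'
    omega
  · ext k
    have := Int.emod_nonneg (γ k) hN'.ne'
    simp only [residue, nsmulAddMonoidHom_apply, Pi.add_apply, nsmul_eq_mul,
      Int.toNat_of_nonneg this]
    exact (Int.emod_add_mul_ediv _ _).symm


/-! ### Hyperplanes spanned by the given vectors -/

section Hyperplanes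

theorem dotProduct_self_pos {a : Fin n → ℚ} (ha : a ≠ 0) : 0 < a ⬝ᵥ a :=
  lt_of_le_of_ne (Finset.sum_nonneg fun i _ => mul_self_nonneg (a i))
    fun h => ha (dotProduct_self_eq_zero.1 h.symm)

theorem mem_orth {a x : Fin n → ℚ} : x ∈ orth a ↔ a ⬝ᵥ x = 0 := Iff.rfl

theorem exists_orth_of_notMem {p : Submodule ℚ (Fin n → ℚ)} {x : Fin n → ℚ} (hx : x ∉ p) :
    ∃ a, a ⬝ᵥ x ≠ 0 ∧ p ≤ orth a := by
  obtain ⟨f, hf, hp⟩ := Submodule.exists_le_ker_of_notMem hx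
  have h : ∀ y, (dotProductEquiv ℚ (Fin n)).symm f ⬝ᵥ y = f y := fun y => by
    conv_rhs => rw [← (dotProductEquiv ℚ (Fin n)).apply_symm_apply f]
    rfl
  refine ⟨(dotProductEquiv ℚ (Fin n)).symm f, by rwa [h], fun y hy => ?_⟩
  rw [mem_orth, h]
  exact hp hy

/-- Hyperplanes that are contained in one another are equal. -/
theorem orth_eq_of_le {a b : Fin n → ℚ} (ha : a ≠ 0) (hb : b ≠ 0) (h : orth a ≤ orth b) :
    orth a = orth b := by
  have haa := (dotProduct_self_pos ha).ne'
  have key : ∀ w, b ⬝ᵥ w = (a ⬝ᵥ w / a ⬝ᵥ a) * (b ⬝ᵥ a) := by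
    intro w
    have h1 : w - (a ⬝ᵥ w / a ⬝ᵥ a) • a ∈ orth a := by
      rw [mem_orth, dotProduct_sub, dotProduct_smul, smul_eq_mul, div_mul_cancel₀ _ haa, sub_self]
    have h2 := mem_orth.1 (h h1)
    rw [dotProduct_sub, dotProduct_smul, smul_eq_mul] at h2
    linarith
  refine le_antisymm h fun y hy => ?_
  have hba : b ⬝ᵥ a ≠ 0 := fun h0 => (dotProduct_self_pos hb).ne' (by rw [key b, h0, mul_zero])
  have h1 := key y
  rw [mem_orth.1 hy] at h1
  have h2 := (mul_eq_zero.1 h1.symm).resolve_right hba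
  exact mem_orth.2 ((div_eq_zero_iff.1 h2).resolve_right haa)

/-- The index sets of `n - 1` given vectors that span a hyperplane. Different index sets may span
the same hyperplane. -/
def WallIndex (α : Fin s → Fin n → ℤ) : Type :=
  {I : Finset (Fin s) // I.card + 1 = n ∧ ∃ a, a ≠ 0 ∧ spanOf α I = orth a}

variable {α : Fin s → Fin n → ℤ}

instance : Finite (WallIndex α) := Subtype.finite

/-- A normal vector of the hyperplane spanned by the vectors in a `WallIndex`. -/
noncomputable def normal (j : WallIndex α) : Fin n → ℚ := j.2.2.choose

theorem normal_ne_zero (j : WallIndex α) : normal j ≠ 0 := j.2.2.choose_spec.1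

theorem spanOf_wallIndex (j : WallIndex α) : spanOf α j.1 = orth (normal j) :=
  j.2.2.choose_spec.2

theorem isSpannedBy_orth_normal (j : WallIndex α) : IsSpannedBy α (orth (normal j)) :=
  ⟨j.1, j.2.1, spanOf_wallIndex j⟩

theorem orth_neg (a : Fin n → ℚ) : orth (-a) = orth a := by
  ext x
  rw [mem_orth, mem_orth, neg_dotProduct, neg_eq_zero]

theorem toRat_mem_spanOf {X : Finset (Fin s)} {i : Fin s} (hi : i ∈ X) :
    toRat (α i) ∈ spanOf α X :=
  Submodule.subset_span ⟨i, hi, rfl⟩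

theorem spanOf_le_iff {X : Finset (Fin s)} {p : Submodule ℚ (Fin n → ℚ)} :
    spanOf α X ≤ p ↔ ∀ i ∈ X, toRat (α i) ∈ p := by
  rw [spanOf, Submodule.span_le]
  constructor
  · exact fun h i hi => h ⟨i, hi, rfl⟩
  · rintro h _ ⟨i, hi, rfl⟩
    exact h i hi

theorem spanOf_univ (hspan : Submodule.span ℚ (Set.range fun i => toRat (α i)) = ⊤) :
    spanOf α Finset.univ = ⊤ := by
  rw [spanOf, Finset.coe_univ, Set.image_univ, hspan]

/-- A subfamily that does not span lies in a hyperplane spanned by `n - 1` of the vectors: extend a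
basis of its span to a basis taken from the whole family and leave out a new vector. -/
theorem exists_wallIndex_of_spanOf_ne_top (hspan : spanOf α Finset.univ = ⊤) {X : Finset (Fin s)}
    (hX : spanOf α X ≠ ⊤) : ∃ j : WallIndex α, spanOf α X ≤ orth (normal j) := by
  set v : Fin s → Fin n → ℚ := fun i => toRat (α i) with hv
  obtain ⟨I₀, hI₀X, -, hspan₀, hli₀⟩ := exists_linearIndepOn_extension (K := ℚ) (v := v)
    (linearIndepOn_empty ℚ v) (Set.empty_subset (X : Set (Fin s)))
  obtain ⟨I₁, -, hI₀₁, hspan₁, hli₁⟩ := exists_linearIndepOn_extension (K := ℚ) (v := v)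
    hli₀ (Set.subset_univ I₀)
  have htop : Submodule.span ℚ (v '' I₁) = ⊤ := by
    rw [eq_top_iff, ← hspan, spanOf, Submodule.span_le, Finset.coe_univ]
    exact hspan₁
  obtain ⟨i, hi₁, hi₀⟩ : ∃ i ∈ I₁, i ∉ I₀ := by
    by_contra! hcon
    refine hX (eq_top_iff.2 ?_)
    rw [← htop]
    exact Submodule.span_mono (Set.image_mono fun i hi => hI₀X (hcon i hi))
  classical
  set B := I₁.toFinset with hB
  have hBcoe : (B : Set (Fin s)) = I₁ := Set.coe_toFinset I₁
  have hcard : B.card = n := by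
    have h1 := linearIndependent_iff_card_eq_finrank_span.1 hli₁
    have h2 : Set.range (fun x : I₁ => v x) = v '' I₁ := Set.image_eq_range v I₁ |>.symm
    rw [Set.finrank, h2, htop, finrank_top, Module.finrank_fin_fun] at h1
    rw [hB, Set.toFinset_card, h1]
  have hiB : i ∈ B := Set.mem_toFinset.2 hi₁
  have hnot : v i ∉ spanOf α (B.erase i) := by
    rw [spanOf, Finset.coe_erase, hBcoe]
    exact hli₁.notMem_span hi₁
  obtain ⟨a, ha, hle⟩ := exists_orth_of_notMem hnot
  have heq : spanOf α (B.erase i) = orth a := by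
    refine le_antisymm hle fun y hy => ?_
    have hy' : y ∈ Submodule.span ℚ (insert (v i) (v '' (B.erase i : Finset (Fin s)))) := by
      rw [← Set.image_insert_eq, ← Finset.coe_insert, Finset.insert_erase hiB, hBcoe, htop]
      trivial
    obtain ⟨c, z, hz, rfl⟩ := Submodule.mem_span_insert.1 hy'
    have h1 := mem_orth.1 hy
    rw [dotProduct_add, mem_orth.1 (hle hz), add_zero, dotProduct_smul, smul_eq_mul] at h1
    rw [(mul_eq_zero.1 h1).resolve_right ha, zero_smul, zero_add]
    exact hz
  have hane : a ≠ 0 := by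
    rintro rfl
    simp at ha
  obtain ⟨j, hj⟩ : ∃ j : WallIndex α, j.1 = B.erase i :=
    ⟨⟨B.erase i, by rw [Finset.card_erase_add_one hiB, hcard], a, hane, heq⟩, rfl⟩
  have h1 : spanOf α X ≤ Submodule.span ℚ (v '' I₀) := Submodule.span_le.2 hspan₀
  refine ⟨j, ?_⟩
  rw [← spanOf_wallIndex, hj]
  refine h1.trans (Submodule.span_mono (Set.image_mono fun k hk => ?_))
  refine Finset.mem_coe.2 (Finset.mem_erase.2 ⟨?_, Set.mem_toFinset.2 (hI₀₁ hk)⟩)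
  rintro rfl
  exact hi₀ hk

theorem exists_dotProduct_ne_zero (hspan : spanOf α Finset.univ = ⊤) {a : Fin n → ℚ}
    (ha : a ≠ 0) : ∃ i, a ⬝ᵥ toRat (α i) ≠ 0 := by
  by_contra! hcon
  have h1 : spanOf α Finset.univ ≤ orth a := spanOf_le_iff.2 fun i _ => hcon i
  rw [hspan] at h1
  exact (dotProduct_self_pos ha).ne' (h1 Submodule.mem_top)

/-- The hyperplanes spanned by `n - 1` of the given vectors have only the origin in common. -/
theorem eq_zero_of_forall_normal (hspan : spanOf α Finset.univ = ⊤) {x : Fin n → ℚ}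
    (hx : ∀ j : WallIndex α, normal j ⬝ᵥ x = 0) : x = 0 := by
  classical
  by_contra hne
  -- a maximal subfamily whose span does not contain `x`
  obtain ⟨X, hX, hmax⟩ := Finset.exists_max_image
    (Finset.univ.filter fun X : Finset (Fin s) => x ∉ spanOf α X) Finset.card
    ⟨∅, Finset.mem_filter.2 ⟨Finset.mem_univ _, by simpa [spanOf] using hne⟩⟩
  have hxX : x ∉ spanOf α X := (Finset.mem_filter.1 hX).2
  obtain ⟨j, hj⟩ := exists_wallIndex_of_spanOf_ne_top hspan
    (fun h : spanOf α X = ⊤ => hxX (h ▸ Submodule.mem_top))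
  obtain ⟨i, hi⟩ := exists_dotProduct_ne_zero hspan (normal_ne_zero j)
  have hiX : i ∉ X := fun h => hi (hj (toRat_mem_spanOf h))
  have hmem : x ∈ spanOf α (insert i X) := by
    by_contra h
    have := hmax _ (Finset.mem_filter.2 ⟨Finset.mem_univ _, h⟩)
    rw [Finset.card_insert_of_notMem hiX] at this
    omega
  rw [spanOf, Finset.coe_insert, Set.image_insert_eq] at hmem
  obtain ⟨c, z, hz, rfl⟩ := Submodule.mem_span_insert.1 hmem
  have h1 := hx j
  rw [dotProduct_add, mem_orth.1 (hj hz), add_zero, dotProduct_smul, smul_eq_mul] at h1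
  rw [(mul_eq_zero.1 h1).resolve_right hi, zero_smul, zero_add] at hxX
  exact hxX hz

/-- Some non-negative integer combination of the vectors lies on none of the hyperplanes. -/
theorem exists_generic (hspan : spanOf α Finset.univ = ⊤) :
    ∃ b : Fin s → ℕ, ∀ j : WallIndex α, normal j ⬝ᵥ toRat (∑ i, b i • α i) ≠ 0 := by
  have := Fintype.ofFinite (WallIndex α)
  -- The coefficients are the powers `1, t, t², …`; a hyperplane that contains the combination makes
  -- `t` a root of one of finitely many non-zero polynomials.
  set f : WallIndex α → Polynomial ℚ := fun j =>
    ∑ i : Fin s, Polynomial.monomial (i : ℕ) (normal j ⬝ᵥ toRat (α i)) with hf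
  have hf0 : ∀ j, f j ≠ 0 := by
    intro j h0
    obtain ⟨i, hi⟩ := exists_dotProduct_ne_zero hspan (normal_ne_zero j)
    apply hi
    have h1 := congrArg (fun p => Polynomial.coeff p (i : ℕ)) h0
    simpa [hf, Polynomial.finsetSum_coeff, Polynomial.coeff_monomial, Fin.val_inj] using h1
  have hex : ∃ t : ℕ, ¬ Polynomial.IsRoot (∏ j, f j) (t : ℚ) := by
    by_contra! hcon
    have hprod : ∏ j, f j ≠ 0 := Finset.prod_ne_zero_iff.2 fun j _ => hf0 j
    refine hprod (Polynomial.eq_zero_of_infinite_isRoot _ ?_)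
    exact (Set.infinite_range_of_injective (Nat.cast_injective (R := ℚ))).mono
      (by rintro _ ⟨t, rfl⟩; exact hcon t)
  obtain ⟨t, ht⟩ := hex
  refine ⟨fun i => t ^ (i : ℕ), fun j => ?_⟩
  have h1 : (f j).eval (t : ℚ) ≠ 0 := by
    rw [Polynomial.IsRoot, Polynomial.eval_prod] at ht
    exact Finset.prod_ne_zero_iff.1 ht j (Finset.mem_univ j)
  rw [toRat_sum_nsmul, dotProduct_sum]
  simp only [hf, Polynomial.eval_finsetSum, Polynomial.eval_monomial] at h1
  simpa only [dotProduct_smul, smul_eq_mul, Nat.cast_pow, mul_comm] using h1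

end Hyperplanes

/-! ### Closed cells of the arrangement -/

section Cells

open SignType

variable {α : Fin s → Fin n → ℤ}

/-- The position of a point with respect to the hyperplanes spanned by the given vectors. -/
noncomputable def signVector (α : Fin s → Fin n → ℤ) (x : Fin n → ℚ) : WallIndex α → SignType :=
  fun j => sign (normal j ⬝ᵥ x)

/-- The closed cell of a sign vector `τ`: on the `j`-th hyperplane if `τ j = 0`, on the given closed
side of it otherwise. -/
def closedCell (τ : WallIndex α → SignType) : Set (Fin n → ℚ) :=
  {x | ∀ j, signVector α x j = 0 ∨ signVector α x j = τ j}

/-- The normals of the half-spaces that cut out the sign condition `t` with respect to `a`. -/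
def cellNormals (t : SignType) (a : Fin n → ℚ) : Finset (Fin n → ℚ) :=
  if t = 0 then {a, -a} else if t = 1 then {a} else {-a}

theorem forall_cellNormals_iff (t : SignType) (a x : Fin n → ℚ) :
    (∀ b ∈ cellNormals t a, 0 ≤ b ⬝ᵥ x) ↔ sign (a ⬝ᵥ x) = 0 ∨ sign (a ⬝ᵥ x) = t := by
  rcases lt_trichotomy (a ⬝ᵥ x) 0 with h | h | h
  · rcases SignType.trichotomy t with rfl | rfl | rfl <;>
      simp [cellNormals, h, h.le, h.not_ge]
  · rcases SignType.trichotomy t with rfl | rfl | rfl <;>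
      simp [cellNormals, h]
  · rcases SignType.trichotomy t with rfl | rfl | rfl <;>
      simp [cellNormals, h, h.le, h.not_ge]

theorem orth_of_mem_cellNormals {t : SignType} {a b : Fin n → ℚ} (hb : b ∈ cellNormals t a) :
    orth b = orth a := by
  have : b = a ∨ b = -a := by
    unfold cellNormals at hb
    split_ifs at hb <;> simp at hb <;> tauto
  rcases this with rfl | rfl
  · rfl
  · exact orth_neg a

theorem isCutOutBy_closedCell (τ : WallIndex α → SignType) : IsCutOutBy α (closedCell τ) := by
  have := Fintype.ofFinite (WallIndex α)
  refine ⟨Finset.univ.biUnion fun j => cellNormals (τ j) (normal j), fun a ha => ?_, ?_⟩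
  · obtain ⟨j, -, hj⟩ := Finset.mem_biUnion.1 ha
    rw [orth_of_mem_cellNormals hj]
    exact isSpannedBy_orth_normal j
  · ext x
    simp only [coneOfNormals, Finset.mem_biUnion, Finset.mem_univ, true_and, Set.mem_ofPred_eq,
      closedCell, forall_exists_index, signVector, ← forall_cellNormals_iff]
    exact forall_comm

theorem signVector_neg (x : Fin n → ℚ) (j : WallIndex α) :
    signVector α (-x) j = -signVector α x j := by
  rw [signVector, dotProduct_neg, Left.sign_neg]
  rfl

theorem isPointedPolyhedralCone_closedCell (hspan : spanOf α Finset.univ = ⊤)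
    (τ : WallIndex α → SignType) : IsPointedPolyhedralCone (closedCell τ) := by
  obtain ⟨A, -, hA⟩ := isCutOutBy_closedCell τ
  refine ⟨⟨A, hA⟩, fun x hx hx' => eq_zero_of_forall_normal hspan fun j => ?_⟩
  have h : signVector α x j = 0 := by
    have h1 := hx j
    have h2 := hx' j
    rw [signVector_neg] at h2
    revert h1 h2
    generalize signVector α x j = y
    generalize τ j = t
    decide +revert
  exact sign_eq_zero_iff.1 h

/-- The sign vectors of the chambers that meet the cone spanned by the given vectors. A chamber is
the set of points with a given sign vector without zeros. -/
def Chamber (α : Fin s → Fin n → ℤ) : Type :=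
  {τ : WallIndex α → SignType // (∀ j, τ j ≠ 0) ∧
    ∃ b : Fin s → ℕ, signVector α (toRat (∑ i, b i • α i)) = τ}

instance : Finite (Chamber α) := Subtype.finite

/-- The normals of a chamber, pointing inwards. -/
noncomputable def Chamber.inner (c : Chamber α) (j : WallIndex α) : Fin n → ℚ :=
  (c.1 j : ℚ) • normal j

theorem Chamber.inner_ne_zero (c : Chamber α) (j : WallIndex α) : c.inner j ≠ 0 := by
  refine smul_ne_zero ?_ (normal_ne_zero j)
  have h := c.2.1 j
  revert h
  rcases SignType.trichotomy (c.1 j) with h | h | h <;> simp [h]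

theorem orth_inner (c : Chamber α) (j : WallIndex α) : orth (c.inner j) = orth (normal j) := by
  have h := c.2.1 j
  rcases SignType.trichotomy (c.1 j) with h1 | h1 | h1
  · rw [Chamber.inner, h1, coe_neg_one, neg_smul, one_smul, orth_neg]
  · exact absurd h1 h
  · rw [Chamber.inner, h1, coe_one, one_smul]

theorem inner_dotProduct_pos_iff (c : Chamber α) (j : WallIndex α) (x : Fin n → ℚ) :
    0 < c.inner j ⬝ᵥ x ↔ signVector α x j = c.1 j := by
  have h := c.2.1 j
  rw [Chamber.inner, smul_dotProduct, smul_eq_mul, signVector]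
  rcases SignType.trichotomy (c.1 j) with h1 | h1 | h1
  · rw [h1, sign_eq_neg_one_iff]; simp
  · exact absurd h1 h
  · rw [h1, sign_eq_one_iff]; simp

theorem mem_closedCell_iff (c : Chamber α) (x : Fin n → ℚ) :
    x ∈ closedCell c.1 ↔ ∀ j, 0 ≤ c.inner j ⬝ᵥ x := by
  refine forall_congr' fun j => ?_
  rw [le_iff_lt_or_eq, inner_dotProduct_pos_iff, or_comm]
  refine or_congr Iff.rfl ?_
  rw [eq_comm (a := (0 : ℚ)), ← mem_orth, orth_inner, mem_orth]
  exact sign_eq_zero_iff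

theorem dotProduct_pos_of_mem_interior {S : Set (Fin n → ℚ)} {a x : Fin n → ℚ} (ha : a ≠ 0)
    (hS : ∀ y ∈ S, 0 ≤ a ⬝ᵥ y) (hx : x ∈ interior S) : 0 < a ⬝ᵥ x := by
  have hcont : Continuous fun ε : ℚ => x - ε • a := by fun_prop
  have h1 : ∀ᶠ ε in 𝓝 (0 : ℚ), x - ε • a ∈ interior S :=
    hcont.continuousAt.eventually (isOpen_interior.mem_nhds (by simpa using hx))
  obtain ⟨ε, hε, hpos⟩ :=
    ((h1.filter_mono nhdsWithin_le_nhds).and (self_mem_nhdsWithin (s := Set.Ioi (0 : ℚ)))).exists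
  have h2 := hS _ (interior_subset hε)
  rw [dotProduct_sub, dotProduct_smul, smul_eq_mul] at h2
  have h3 := mul_pos (show 0 < ε from hpos) (dotProduct_self_pos ha)
  linarith

theorem openCone_subset_interior (c : Chamber α) :
    openCone c.inner ⊆ interior (closedCell c.1) := by
  refine interior_maximal (fun x hx => (mem_closedCell_iff c x).2 fun j => (hx j).le) ?_
  have : openCone c.inner = ⋂ j, {x | 0 < c.inner j ⬝ᵥ x} := by
    ext x; simp [openCone]
  rw [this]
  exact isOpen_iInter_of_finite fun j =>
    isOpen_lt continuous_const (continuous_const.dotProduct continuous_id)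

theorem mem_openCone_of_mem_interior {c : Chamber α} {x : Fin n → ℚ}
    (hx : x ∈ interior (closedCell c.1)) : x ∈ openCone c.inner := fun j =>
  dotProduct_pos_of_mem_interior (c.inner_ne_zero j)
    (fun y hy => (mem_closedCell_iff c y).1 hy j) hx

theorem exists_mem_openCone (c : Chamber α) :
    ∃ b : Fin s → ℕ, toRat (∑ i, b i • α i) ∈ openCone c.inner := by
  obtain ⟨b, hb⟩ := c.2.2
  exact ⟨b, fun j => (inner_dotProduct_pos_iff c j _).2 (congrFun hb j)⟩

theorem interior_nonempty (c : Chamber α) : (interior (closedCell c.1)).Nonempty := by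
  obtain ⟨b, hb⟩ := exists_mem_openCone c
  exact ⟨_, openCone_subset_interior c hb⟩

theorem disjoint_interior {c c' : Chamber α} (h : c ≠ c') :
    Disjoint (interior (closedCell c.1)) (interior (closedCell c'.1)) := by
  rw [Set.disjoint_left]
  refine fun x hx hx' => h (Subtype.ext (funext fun j => ?_))
  rw [← (inner_dotProduct_pos_iff c j x).1 (mem_openCone_of_mem_interior hx j),
    (inner_dotProduct_pos_iff c' j x).1 (mem_openCone_of_mem_interior hx' j)]

/-- If a wall lay in none of the hyperplanes of the arrangement, the sum of suitable points of the
wall would be an interior point of the chamber. -/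
theorem isSpannedBy_of_isWallHyperplane {c : Chamber α} {H : Submodule ℚ (Fin n → ℚ)}
    (hH : IsWallHyperplane (closedCell c.1) H) : IsSpannedBy α H := by
  have := Fintype.ofFinite (WallIndex α)
  obtain ⟨a, ha, rfl, hpos, hspan⟩ := hH
  obtain ⟨j, hj⟩ : ∃ j : WallIndex α, ∀ x ∈ closedCell c.1, x ∈ orth a → x ∈ orth (normal j) := by
    by_contra! hcon
    choose x hx hxa hxj using hcon
    have hmem : ∑ j, x j ∈ openCone c.inner := by
      intro i
      rw [dotProduct_sum]
      refine Finset.sum_pos' (fun j _ => (mem_closedCell_iff c _).1 (hx j) i)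
        ⟨i, Finset.mem_univ i, ?_⟩
      refine lt_of_le_of_ne ((mem_closedCell_iff c _).1 (hx i) i) fun h => hxj i ?_
      rw [← orth_inner c i]
      exact h.symm
    have h1 := dotProduct_pos_of_mem_interior ha hpos (openCone_subset_interior c hmem)
    have h2 : ∑ j, x j ∈ orth a := sum_mem fun j _ => hxa j
    exact h1.ne' h2
  have hle : orth a ≤ orth (normal j) := by
    conv_lhs => rw [← hspan]
    exact Submodule.span_le.2 fun x hx => hj x hx.1 hx.2
  rw [orth_eq_of_le ha (normal_ne_zero j) hle]
  exact isSpannedBy_orth_normal j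

/-- Moving a point of the cone spanned by the given vectors slightly in a generic direction leads
into a chamber whose closure contains the point. -/
theorem exists_chamber (hspan : spanOf α Finset.univ = ⊤) (a : Fin s → ℕ) :
    ∃ c : Chamber α, toRat (∑ i, a i • α i) ∈ closedCell c.1 := by
  obtain ⟨b, hb⟩ := exists_generic hspan
  set x := toRat (∑ i, a i • α i) with hx
  set p := toRat (∑ i, b i • α i) with hp
  have hL : ∀ᶠ L : ℕ in atTop, ∀ j : WallIndex α,
      signVector α ((L : ℚ) • x + p) j ≠ 0 ∧
        (signVector α x j = 0 ∨ signVector α x j = signVector α ((L : ℚ) • x + p) j) := by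
    refine eventually_all.2 fun j => ?_
    have hval : ∀ L : ℕ, normal j ⬝ᵥ ((L : ℚ) • x + p) = L * (normal j ⬝ᵥ x) + normal j ⬝ᵥ p := by
      intro L
      rw [dotProduct_add, dotProduct_smul, smul_eq_mul]
    simp only [signVector, hval]
    rcases lt_trichotomy (normal j ⬝ᵥ x) 0 with h | h | h
    · have h1 : Tendsto (fun L : ℕ => (L : ℚ) * (normal j ⬝ᵥ x)) atTop atBot :=
        tendsto_natCast_atTop_atTop.atTop_mul_const_of_neg h
      filter_upwards [h1.eventually_lt_atBot (-(normal j ⬝ᵥ p))] with L hL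
      rw [sign_neg h, sign_neg (by linarith)]
      simp
    · refine Eventually.of_forall fun L => ⟨?_, Or.inl (by rw [h, sign_zero])⟩
      rw [h, mul_zero, zero_add]
      exact sign_ne_zero.2 (hb j)
    · have h1 : Tendsto (fun L : ℕ => (L : ℚ) * (normal j ⬝ᵥ x)) atTop atTop :=
        tendsto_natCast_atTop_atTop.atTop_mul_const h
      filter_upwards [h1.eventually_gt_atTop (-(normal j ⬝ᵥ p))] with L hL
      rw [sign_pos h, sign_pos (by linarith)]
      simp
  obtain ⟨L, hL⟩ := hL.exists
  refine ⟨⟨signVector α ((L : ℚ) • x + p), fun j => (hL j).1, fun i => L * a i + b i, ?_⟩,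
    fun j => (hL j).2⟩
  congr 1
  rw [hx, hp, ← toRat_nsmul, ← toRat_add]
  congr 1
  rw [Finset.smul_sum, ← Finset.sum_add_distrib]
  exact Finset.sum_congr rfl fun i _ => by rw [add_smul, mul_smul]

end Cells


/-! ### Quasipolynomials on the closed chambers -/

section Chambers

variable {α : Fin s → Fin n → ℤ}

/-- The partition function is a quasipolynomial, with a common period `N`, on each closed chamber
that meets the cone spanned by the given vectors. -/
theorem exists_chamber_polynomials (hnonneg : ∀ i k, 0 ≤ α i k) (hne : ∀ i, α i ≠ 0)
    (hspan : spanOf α Finset.univ = ⊤) :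
    ∃ N : ℕ, 0 < N ∧ ∃ Q : Chamber α → (Fin n → Fin N) → MvPolynomial (Fin n) ℚ,
      ∀ c r γ, γ ∈ closedCell c.1 → γ ∈ shift (residue r) (multiples n N) →
        (partitionFunction α γ : ℚ) = MvPolynomial.eval γ (Q c r) := by
  obtain ⟨N, hNpos, hN⟩ := exists_multiplier α
  have hq : ∀ c : Chamber α, ∃ q : (Fin n → ℤ) → ℚ,
      (∀ v : Fin n → ℤ, (fwdDiff (N • v))^[s + 1] q = 0) ∧
        ∀ γ, (∀ j, 0 ≤ c.inner j ⬝ᵥ toRat γ) → subCount α Finset.univ γ = q γ := by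
    intro c
    obtain ⟨b, hb⟩ := exists_mem_openCone c
    refine exists_subCount_eq_on_closed_chamber hnonneg hne (fun X hX => ?_) hNpos hN hb
    obtain ⟨j, hj⟩ := exists_wallIndex_of_spanOf_ne_top hspan hX
    rw [← orth_inner c] at hj
    exact ⟨j, spanOf_le_iff.1 hj⟩
  choose q hq0 hq using hq
  choose Q hQ using fun (c : Chamber α) (r : Fin n → Fin N) =>
    exists_eval_eq_on_residue_class hNpos (hq0 c) (residue r)
  refine ⟨N, hNpos, Q, fun c r γ hγ hγr => ?_⟩
  obtain ⟨l, hl, rfl⟩ := hγr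
  rw [partitionFunction_toRat, hq c _ ((mem_closedCell_iff c _).1 hγ), hQ c r l hl]

theorem exists_decomposition_of_ne_zero {γ : Fin n → ℚ} (h : partitionFunction α γ ≠ 0) :
    ∃ a : Fin s → ℕ, toRat (∑ i, a i • α i) = γ := by
  obtain ⟨a, ha⟩ := Set.nonempty_of_ncard_ne_zero h
  exact ⟨a, (toRat_sum_nsmul α a).trans ha⟩

theorem exists_chamber_of_ne_zero (hspan : spanOf α Finset.univ = ⊤) {γ : Fin n → ℚ}
    (h : partitionFunction α γ ≠ 0) : ∃ c : Chamber α, γ ∈ closedCell c.1 := by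
  obtain ⟨a, rfl⟩ := exists_decomposition_of_ne_zero h
  exact exists_chamber hspan a

theorem exists_shift_of_ne_zero {N : ℕ} (hN : 0 < N) {γ : Fin n → ℚ}
    (h : partitionFunction α γ ≠ 0) :
    ∃ r : Fin n → Fin N, γ ∈ shift (residue r) (multiples n N) := by
  obtain ⟨a, rfl⟩ := exists_decomposition_of_ne_zero h
  obtain ⟨r, l, hl, heq⟩ := exists_residue hN (∑ i, a i • α i)
  exact ⟨r, l, hl, by rw [heq]⟩

theorem residue_eq_of_mem_shift {N : ℕ} {r r' : Fin n → Fin N} {γ : Fin n → ℚ}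
    (h : γ ∈ shift (residue r) (multiples n N)) (h' : γ ∈ shift (residue r') (multiples n N)) :
    r = r' := by
  obtain ⟨l, hl, rfl⟩ := h
  obtain ⟨l', hl', heq⟩ := h'
  have h1 := toRat_injective heq
  refine residue_injective_mod ?_
  have h2 : residue r - residue r' = l' - l := by
    rw [sub_eq_sub_iff_add_eq_add, h1, add_comm]
  rw [h2]
  exact sub_mem hl' hl

theorem ind_of_mem {X : Set (Fin n → ℚ)} {γ : Fin n → ℚ} (h : γ ∈ X) : ind X γ = 1 :=
  Set.indicator_of_mem h _

theorem ind_of_notMem {X : Set (Fin n → ℚ)} {γ : Fin n → ℚ} (h : γ ∉ X) : ind X γ = 0 :=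
  Set.indicator_of_notMem h _

/-- A point that is not integral lies in no residue class, and both sides are `0`. -/
theorem partitionFunction_eq_sum_residues {N : ℕ} (hN : 0 < N)
    {Q : (Fin n → Fin N) → MvPolynomial (Fin n) ℚ} {γ : Fin n → ℚ}
    (hQ : ∀ r, γ ∈ shift (residue r) (multiples n N) →
      (partitionFunction α γ : ℚ) = MvPolynomial.eval γ (Q r)) :
    (partitionFunction α γ : ℚ) =
      ∑ r, ind (shift (residue r) (multiples n N)) γ * MvPolynomial.eval γ (Q r) := by
  by_cases h : ∃ r : Fin n → Fin N, γ ∈ shift (residue r) (multiples n N)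
  · obtain ⟨r, hr⟩ := h
    rw [Finset.sum_eq_single r, ind_of_mem hr, one_mul, hQ r hr]
    · intro r' _ hr'
      rw [ind_of_notMem fun h => hr' (residue_eq_of_mem_shift h hr), zero_mul]
    · simp
  · have h0 : partitionFunction α γ = 0 := by
      by_contra h1
      exact h (exists_shift_of_ne_zero hN h1)
    rw [h0, Nat.cast_zero, eq_comm]
    refine Finset.sum_eq_zero fun r _ => ?_
    rw [ind_of_notMem fun hr => h ⟨r, hr⟩, zero_mul]

end Chambers

/-! ### Indicators of relatively open cells -/

section Faces

/-- The coefficients that express the indicator of `sign y = u` by the indicators of the closed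
conditions `sign y ∈ {0, t}`. -/
def faceCoeff (t u : SignType) : ℚ :=
  if t = u then 1 else if t = 0 then -1 else 0

theorem sum_ite_mul_faceCoeff (y u : SignType) :
    ∑ t : SignType, (if y = 0 ∨ y = t then 1 else 0) * faceCoeff t u =
      if y = u then 1 else 0 := by
  rw [SignType.univ_eq]
  rcases SignType.trichotomy y with rfl | rfl | rfl <;>
    rcases SignType.trichotomy u with rfl | rfl | rfl <;> simp [faceCoeff]

variable {α : Fin s → Fin n → ℤ} [Fintype (WallIndex α)]

theorem ind_closedCell (τ : WallIndex α → SignType) (x : Fin n → ℚ) :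
    ind (closedCell τ) x =
      ∏ j, if signVector α x j = 0 ∨ signVector α x j = τ j then 1 else 0 := by
  rw [Finset.prod_boole]
  by_cases h : x ∈ closedCell τ
  · rw [ind_of_mem h, if_pos fun j _ => h j]
  · rw [ind_of_notMem h, if_neg fun h' => h fun j => h' j (Finset.mem_univ j)]

variable [DecidableEq (WallIndex α)]

theorem sum_ind_closedCell_mul_faceCoeff (σ : WallIndex α → SignType) (x : Fin n → ℚ) :
    ∑ τ : WallIndex α → SignType, ind (closedCell τ) x * ∏ j, faceCoeff (τ j) (σ j) =
      if signVector α x = σ then 1 else 0 := by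
  simp only [ind_closedCell, ← Finset.prod_mul_distrib]
  rw [← Fintype.piFinset_univ, ← Finset.prod_univ_sum (fun _ => Finset.univ)
    (fun j t => (if signVector α x j = 0 ∨ signVector α x j = t then 1 else 0) *
      faceCoeff t (σ j))]
  simp only [sum_ite_mul_faceCoeff, Finset.prod_boole, Finset.mem_univ, true_imp_iff, funext_iff]

/-- A function given by `∑ r, g r * Q σ r` on each relatively open cell `σ` is a combination of the
indicators of the closed cells. -/
theorem sum_ind_closedCell {β : Type*} [Fintype β] (g : β → ℚ)
    (Q : (WallIndex α → SignType) → β → MvPolynomial (Fin n) ℚ) (x : Fin n → ℚ) :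
    ∑ τ : WallIndex α → SignType, ∑ r, ind (closedCell τ) x * g r *
      MvPolynomial.eval x (∑ σ : WallIndex α → SignType,
        MvPolynomial.C (∏ j, faceCoeff (τ j) (σ j)) * Q σ r) =
      ∑ r, g r * MvPolynomial.eval x (Q (signVector α x) r) := by
  rw [Finset.sum_comm]
  refine Finset.sum_congr rfl fun r _ => ?_
  simp only [map_sum, map_mul, MvPolynomial.eval_C, Finset.mul_sum]
  rw [Finset.sum_comm]
  have h : ∀ σ : WallIndex α → SignType,
      ∑ τ : WallIndex α → SignType, ind (closedCell τ) x * g r *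
        ((∏ j, faceCoeff (τ j) (σ j)) * MvPolynomial.eval x (Q σ r)) =
      (if signVector α x = σ then 1 else 0) * (g r * MvPolynomial.eval x (Q σ r)) := by
    intro σ
    rw [← sum_ind_closedCell_mul_faceCoeff, Finset.sum_mul]
    exact Finset.sum_congr rfl fun τ _ => by ring
  simp only [h]
  simp

end Faces

end VectorPartition

theorem mainTheorem1 (n s : ℕ) (α : Fin s → Fin n → ℤ)
    (hnonneg : ∀ i k, 0 ≤ α i k) (hne : ∀ i, α i ≠ 0)
    (hspan : Submodule.span ℚ (Set.range fun i => VectorPartition.toRat (α i)) = ⊤) :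
    ∃ (Λ : AddSubgroup (Fin n → ℤ)) (m : ℕ) (δ : Fin m → Fin n → ℤ)
      (N : ℕ) (D : Fin N → Set (Fin n → ℚ)) (Q : Fin N → Fin m → MvPolynomial (Fin n) ℚ),
      VectorPartition.IsFullRankLattice Λ ∧
      (∀ j j', δ j - δ j' ∈ Λ → j = j') ∧
      -- the cones are pointed, full-dimensional, and have pairwise disjoint interiors
      (∀ i, VectorPartition.IsPointedPolyhedralCone (D i)) ∧
      (∀ i, (interior (D i)).Nonempty) ∧
      (∀ i i', i ≠ i' → Disjoint (interior (D i)) (interior (D i'))) ∧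
      -- the walls are spanned by `n - 1` of the given vectors
      (∀ i, VectorPartition.IsCutOutBy α (D i)) ∧
      (∀ i H, VectorPartition.IsWallHyperplane (D i) H → VectorPartition.IsSpannedBy α H) ∧
      -- the case formula
      (∀ γ i j, γ ∈ D i → γ ∈ VectorPartition.shift (δ j) Λ →
        (VectorPartition.partitionFunction α γ : ℚ) = MvPolynomial.eval γ (Q i j)) ∧
      (∀ γ, (∀ i j, ¬ (γ ∈ D i ∧ γ ∈ VectorPartition.shift (δ j) Λ)) →
        VectorPartition.partitionFunction α γ = 0) ∧
      -- the sum formula with the same data, off the overlaps of the cones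
      (∀ γ, (∀ i i', γ ∈ D i → γ ∈ D i' → i = i') →
        (VectorPartition.partitionFunction α γ : ℚ) =
          ∑ i, ∑ j, VectorPartition.ind (D i) γ *
            VectorPartition.ind (VectorPartition.shift (δ j) Λ) γ *
              MvPolynomial.eval γ (Q i j)) ∧
      -- the sum formula everywhere, with cones that may be of smaller dimension
      (∃ (M : ℕ) (E : Fin M → Set (Fin n → ℚ)) (R : Fin M → Fin m → MvPolynomial (Fin n) ℚ),
        (∀ i, VectorPartition.IsPointedPolyhedralCone (E i)) ∧
        (∀ i, VectorPartition.IsCutOutBy α (E i)) ∧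
        ∀ γ, (VectorPartition.partitionFunction α γ : ℚ) =
          ∑ i, ∑ j, VectorPartition.ind (E i) γ *
            VectorPartition.ind (VectorPartition.shift (δ j) Λ) γ *
              MvPolynomial.eval γ (R i j)) := by
  classical
  have htop := VectorPartition.spanOf_univ hspan
  obtain ⟨N, hN, Q, hQ⟩ := VectorPartition.exists_chamber_polynomials hnonneg hne htop
  have := Fintype.ofFinite (VectorPartition.Chamber α)
  have := Fintype.ofFinite (VectorPartition.WallIndex α)
  set e := Fintype.equivFin (VectorPartition.Chamber α)
  set r := Fintype.equivFin (Fin n → Fin N)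
  set f := Fintype.equivFin (VectorPartition.WallIndex α → SignType)
  refine ⟨VectorPartition.multiples n N, _, fun j => VectorPartition.residue (r.symm j), _,
    fun i => VectorPartition.closedCell (e.symm i).1, fun i j => Q (e.symm i) (r.symm j),
    VectorPartition.isFullRankLattice_multiples hN,
    fun j j' h => r.symm.injective (VectorPartition.residue_injective_mod h),
    fun i => VectorPartition.isPointedPolyhedralCone_closedCell htop _,
    fun i => VectorPartition.interior_nonempty _,
    fun i i' h => VectorPartition.disjoint_interior (e.symm.injective.ne h),
    fun i => VectorPartition.isCutOutBy_closedCell _,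
    fun i H hH => VectorPartition.isSpannedBy_of_isWallHyperplane hH,
    fun γ i j hi hj => hQ _ _ γ hi hj, fun γ hγ => ?_, fun γ hγ => ?_, _,
    fun k => VectorPartition.closedCell (f.symm k), ?_⟩
  · by_contra h
    obtain ⟨c, hc⟩ := VectorPartition.exists_chamber_of_ne_zero htop h
    obtain ⟨t, ht⟩ := VectorPartition.exists_shift_of_ne_zero hN h
    exact hγ (e c) (r t) ⟨by simpa using hc, by simpa using ht⟩
  · have hj : ∀ i, ∑ j, VectorPartition.ind (VectorPartition.closedCell (e.symm i).1) γ *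
        VectorPartition.ind (VectorPartition.shift (VectorPartition.residue (r.symm j))
          (VectorPartition.multiples n N)) γ * MvPolynomial.eval γ (Q (e.symm i) (r.symm j)) =
        VectorPartition.ind (VectorPartition.closedCell (e.symm i).1) γ *
          VectorPartition.partitionFunction α γ := by
      intro i
      by_cases hi : γ ∈ VectorPartition.closedCell (e.symm i).1
      · simp only [VectorPartition.ind_of_mem hi, one_mul]
        rw [VectorPartition.partitionFunction_eq_sum_residues hN fun t => hQ (e.symm i) t γ hi,
          ← r.symm.sum_comp]
      · simp [VectorPartition.ind_of_notMem hi]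
    simp only [hj]
    by_cases h : VectorPartition.partitionFunction α γ = 0
    · simp [h]
    · obtain ⟨c, hc⟩ := VectorPartition.exists_chamber_of_ne_zero htop h
      have hc' : γ ∈ VectorPartition.closedCell (e.symm (e c)).1 := by simpa using hc
      rw [Finset.sum_eq_single (e c), VectorPartition.ind_of_mem hc', one_mul]
      · intro i _ hi
        rw [VectorPartition.ind_of_notMem fun h => hi (hγ i (e c) h hc'), zero_mul]
      · simp
  · -- the polynomial on a relatively open cell is that of some chamber above it, if there is one
    set Q' : (VectorPartition.WallIndex α → SignType) → (Fin n → Fin N) →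
        MvPolynomial (Fin n) ℚ := fun σ t =>
      if h : ∃ c : VectorPartition.Chamber α, ∀ j, σ j = 0 ∨ σ j = c.1 j then Q h.choose t else 0
      with hQ'
    refine ⟨fun k j => ∑ σ : VectorPartition.WallIndex α → SignType,
      MvPolynomial.C (∏ i, VectorPartition.faceCoeff (f.symm k i) (σ i)) * Q' σ (r.symm j),
      fun k => VectorPartition.isPointedPolyhedralCone_closedCell htop _,
      fun k => VectorPartition.isCutOutBy_closedCell _, fun γ => ?_⟩
    have hP : (VectorPartition.partitionFunction α γ : ℚ) = ∑ t,
        VectorPartition.ind (VectorPartition.shift (VectorPartition.residue t)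
          (VectorPartition.multiples n N)) γ *
          MvPolynomial.eval γ (Q' (VectorPartition.signVector α γ) t) := by
      by_cases h : ∃ c : VectorPartition.Chamber α, ∀ j,
          VectorPartition.signVector α γ j = 0 ∨ VectorPartition.signVector α γ j = c.1 j
      · refine VectorPartition.partitionFunction_eq_sum_residues hN fun t ht => ?_
        rw [hQ h.choose t γ h.choose_spec ht]
        simp only [hQ', dif_pos h]
      · have h0 : VectorPartition.partitionFunction α γ = 0 := by
          by_contra h1
          exact h (VectorPartition.exists_chamber_of_ne_zero htop h1)
        simp [hQ', dif_neg h, h0]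
    rw [hP, ← VectorPartition.sum_ind_closedCell (fun t : Fin n → Fin N =>
      VectorPartition.ind (VectorPartition.shift (VectorPartition.residue t)
        (VectorPartition.multiples n N)) γ) Q' γ, ← f.symm.sum_comp]
    exact Finset.sum_congr rfl fun k _ => (r.symm.sum_comp _).symm
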